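/- **Model.** A network is a finite simple graph $G$ on vertices (agents) $1,\dots,n$ in which every agent numbers its incident edges (ports) and the agents carry pairwise distinct identifiers in $\mathbb N$; the vertex labels are not known to the agents. $G$ is *2-connected* if $n\ge 3$, $G$ is connected, and $G$ stays connected after the removal of any one vertex. Each agent has an input from a finite non-empty set $X$. A *strategy* of an agent is a randomised state machine with an arbitrary state space: the initial state is drawn knowing only the agent's own identifier, degree and input; in each synchronous round the agent sends one message through each of its ports, receives one message through each port and draws its next state; at some time it may irrevocably output a value of a finite set $Y$ or $\bot$. Agents randomise independently. A *protocol* is a strategy $\Lambda$ executed by all agents. A *deviation* of an agent is any strategy of that agent while all other agents run $\Lambda$ (so it may behave on its ports as if it were a whole subgraph of fictitious agents). **Problem.** Let $|Y|=k\ge 2$ and let $q$ assign to each input vector $(x_1,\dots,x_m)\in X^m$, for every $m$, a value in $Y$, such that (full knowledge) for all $m$, all $j\le m$ and all fixed $x_l$ $(l\neq j)$ the number $|\{x_j\in X: q(x_1,\dots,x_m)=y\}|$ is the same for all $y\in Y$. Let $\sigma$ be a probability distribution on $\mathbb N$. A protocol $\Lambda$ *solves Knowledge Sharing* for $q$ and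 $\sigma$ if on every 2-connected network whose size $n$ satisfies $\sigma(n)>0$, and for all inputs, with probability one every agent eventually outputs $q(x_1,\dots,x_n)$. An output vector is *legal* if all agents output the same value, different from $\bot$. The utility $u_a$ of an agent $a$ with preferred value $p\in Y$ is $1$ if the output vector is legal and $a$ outputs $p$, and $0$ otherwise (an agent that never terminates counts as outputting $\bot$). An agent does not know the network or its position in it. It has a prior $B$ over pairs (network, position), and the inputs of the other agents are independent and uniform on $X$. For a strategy $S$ of this agent, $\mathbb E_{S}[u_a\mid i]$ denotes its expected utility under the prior $B$ when its own input is $i$, it behaves according to $S$ and all other agents run $\Lambda$; $\mathbb E_{S}[u_a\mid N,i]$ denotes the same expectation when the network and position are $N$. **Theorem.** Suppose that $\sigma$ has infinite support in the sense that there is $n_0$ with $\sigma(m)>0$ for all $m>n_0$. Let $\Lambda$ be a protocol that solves Knowledge Sharing for $q$ and $\sigma$. Let $p\in Y$, and let $\tau$ be any probability distribution over pairs (2-connected port-numbered graph, position of the agent) whose marginal on the number of vertices is $\sigma$. Then identifiers can be added so that $\Lambda$ is not an equilibrium: there is a prior $B$ over pairs (network, position) whose marginal on pairs (port-numbered graph,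 position) is $\tau$ and under which the agent's own identifier is constant, and there is a strategy $D$ of the agent, such that $$\mathbb E_{D}[u_a\mid i]>\mathbb E_{\Lambda}[u_a\mid i]\qquad\text{for every own input } i\in X ,$$ and moreover there is a network and position $N$ in the support of $B$ with $\mathbb E_{D}[u_a\mid N,i]>\mathbb E_{\Lambda}[u_a\mid N,i]$ for every $i\in X$. In particular, no protocol for Knowledge Sharing is an equilibrium in 2-connected graphs when the agents' prior on $n$ has infinite support. -/

import Mathlib

open scoped ENNReal

noncomputable section

namespace KnowledgeSharing

/-! ### Product of finitely many discrete distributions -/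

theorem tsum_prod_eq_one : ∀ {n : ℕ} {α : Fin n → Type} (P : ∀ i, PMF (α i)),
    ∑' c : (∀ i, α i), ∏ i, P i (c i) = 1
  | 0, α, P => by
      rw [tsum_eq_single (fun i => i.elim0) (fun c hc => (hc (funext fun i => i.elim0)).elim)]
      simp
  | n + 1, α, P => by
      rw [← (Fin.consEquiv α).tsum_eq, ENNReal.tsum_prod']
      simp only [Fin.consEquiv, Equiv.coe_fn_mk, Fin.prod_univ_succ, Fin.cons_zero, Fin.cons_succ]
      simp only [ENNReal.tsum_mul_left, tsum_prod_eq_one (fun i => P i.succ), mul_one]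
      exact (P 0).tsum_coe

/-- The joint law of independent draws, one from each `P i`. -/
def independent {n : ℕ} {α : Fin n → Type} (P : ∀ i, PMF (α i)) : PMF (∀ i, α i) :=
  ⟨fun c => ∏ i, P i (c i), by
    rw [← tsum_prod_eq_one P]; exact ENNReal.summable.hasSum⟩

/-! ### Networks -/

/-- A finite simple graph on the labels `Fin n` in which every vertex `v` has numbered its
`deg v` incident edges. Neither the labels nor the identity of the neighbour behind a port is
known to the agents. -/
structure Topology where
  n : ℕ
  G : SimpleGraph (Fin n)
  deg : Fin n → ℕ
  port : ∀ v, Fin (deg v) ≃ G.neighborSet v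

/-- 2-vertex-connectedness: at least three vertices, connected, and still connected after the
removal of any one vertex. -/
def TwoConnected {n : ℕ} (G : SimpleGraph (Fin n)) : Prop :=
  3 ≤ n ∧ G.Connected ∧ ∀ v : Fin n, (G.induce {v}ᶜ).Connected

/-- A topology together with pairwise distinct identifiers of the agents. -/
structure Network extends Topology where
  ident : Fin n → ℕ
  ident_injective : Function.Injective ident

/-- A topology seen from one agent: the graph and the position of the agent in it. -/
abbrev PointedTopology := Σ T : Topology, Fin T.n

/-- A network seen from one agent: the network and the position of the agent in it. -/
abbrev PointedNetwork := Σ N : Network, Fin N.n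

/-- Forget the identifiers. -/
def PointedNetwork.topology (N : PointedNetwork) : PointedTopology := ⟨N.1.toTopology, N.2⟩

/-! ### Randomised synchronous behaviour of a single agent -/

/-- What one agent does, as a randomised state machine with arbitrary (unbounded) state space.
`X`, `M`, `Y` are the types of inputs, of messages and of output values.
The initial state is drawn knowing only the agent's own identifier, its number of ports and its
input. In every round an agent in state `s` sends `msg s i` through its `i`-th port (only the
`i` below its number of ports matter), receives one message per port, and draws its next state.
`out s` is `none` while the agent has not terminated, `some none` if it has output `⊥`, and
`some (some y)` if it has output `y`; an output is never revised.

A protocol is such a behaviour executed by all agents; a deviation of one agent is an arbitrary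
such behaviour of that agent. Since agents only see messages on ports, a deviation may in
particular act on different ports as different fictitious agents. -/
structure Strategy (X M Y : Type) where
  State : Type
  init : (ident deg : ℕ) → X → PMF State
  msg : State → ℕ → M
  step : State → (deg : ℕ) → (Fin deg → M) → PMF State
  out : State → Option (Option Y)
  out_step : ∀ s deg r o, out s = some o → ∀ s' ∈ (step s deg r).support, out s' = some o

/-! ### Executions -/

section Execution

variable {X M Y : Type} (N : Network) (prof : Fin N.n → Strategy X M Y)

/-- A global configuration: the state of every agent. -/
abbrev Config := ∀ v, (prof v).State

variable {prof} in
/-- The message that reaches `v` through its port `i`: the one that the neighbour behind this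
port sends through its own port to `v`. -/
def received (c : Config N prof) (v : Fin N.n) (i : Fin (N.deg v)) : M :=
  let w := N.port v i
  (prof w).msg (c w) ((N.port w).symm ⟨v, SimpleGraph.Adj.symm w.2⟩ : Fin (N.deg w))

/-- The law of the configuration after `t` rounds, for the inputs `x`. -/
def configLaw (x : Fin N.n → X) : ℕ → PMF (Config N prof)
  | 0 => independent fun v => (prof v).init (N.ident v) (N.deg v) (x v)
  | t + 1 => (configLaw x t).bind fun c =>
      independent fun v => (prof v).step (c v) (N.deg v) (received N c v)

variable {prof} in
/-- The output vector in a configuration; `none` stands for `⊥`, which is also the entry of an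
agent that has not terminated. -/
def outputs (c : Config N prof) (v : Fin N.n) : Option Y := ((prof v).out (c v)).join

end Execution

/-! ### The problem -/

/-- Legal output vectors: all agents output the same value, which is not `⊥`. -/
def Legal {n : ℕ} {Y : Type} (O : Fin n → Option Y) : Prop :=
  ∀ a b, O a = O b ∧ O a ≠ none

open Classical in
/-- The utility of agent `a` with preferred value `p`. -/
def utility {n : ℕ} {Y : Type} (a : Fin n) (p : Y) (O : Fin n → Option Y) : ℝ≥0∞ :=
  if O a = some p ∧ Legal O then 1 else 0

/-- The full knowledge property of a function `q` with output space `Y`, defined on input vectors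
of every length: when all inputs but the `j`-th are fixed, every output value is attained for
the same number of values of the `j`-th input. -/
def FullKnowledge {X Y : Type} (q : ∀ m : ℕ, (Fin m → X) → Y) : Prop :=
  ∀ (m : ℕ) (j : Fin m) (x : Fin m → X) (y y' : Y),
    Nat.card {z : X // q m (Function.update x j z) = y} =
      Nat.card {z : X // q m (Function.update x j z) = y'}

/-- A prior on the network size has infinite support if all large sizes are possible. -/
def InfiniteSupport (σ : PMF ℕ) : Prop := ∃ n₀ : ℕ, ∀ m > n₀, 0 < σ m

/-- `Λ` is a Knowledge Sharing protocol for `q` and the prior `σ`: on every 2-connected network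
of a possible size and for all inputs, with probability one every agent running `Λ` eventually
outputs the value of `q` at the vector of all inputs. -/
def SolvesKnowledgeSharing {X M Y : Type} (q : ∀ m : ℕ, (Fin m → X) → Y) (σ : PMF ℕ)
    (Λ : Strategy X M Y) : Prop :=
  ∀ N : Network, TwoConnected N.G → N.n ∈ σ.support → ∀ x : Fin N.n → X,
    ⨆ t, (configLaw N (fun _ => Λ) x t).toOuterMeasure
      {c | ∀ v, outputs N c v = some (q N.n x)} = 1

/-! ### Expected utility -/

section Utility

variable {X M Y : Type}

/-- Expected utility of `a` in an execution with inputs `x`. Outputs are never revised, so the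
expectation of the utility of the configuration after `t` rounds increases with `t`; its limit
is the expected utility of the final output vector. -/
def runUtility (N : Network) (prof : Fin N.n → Strategy X M Y) (a : Fin N.n) (p : Y)
    (x : Fin N.n → X) : ℝ≥0∞ :=
  ⨆ t, ∑' c, configLaw N prof x t c * utility a p (outputs N c)

/-- Expected utility, in the network `N`, of the agent at position `N.2` with input `i` and
preferred value `p`, when it behaves according to `S` and all others run `Λ`; the inputs of the
other agents are independent and uniform. -/
def networkUtility [Fintype X] [Nonempty X] (Λ S : Strategy X M Y) (p : Y) (i : X)
    (N : PointedNetwork) : ℝ≥0∞ :=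
  ∑' x : Fin N.1.n → X, PMF.uniformOfFintype (Fin N.1.n → X) x *
    runUtility N.1 (Function.update (fun _ => Λ) N.2 S) N.2 p (Function.update x N.2 i)

/-- Expected utility of behaving according to `S`, as estimated at the start by an agent with
input `i`, preferred value `p` and prior `B` over the network and its own position in it. -/
def expectedUtility [Fintype X] [Nonempty X] (Λ S : Strategy X M Y) (p : Y) (i : X)
    (B : PMF PointedNetwork) : ℝ≥0∞ :=
  ∑' N, B N * networkUtility Λ S p i N

end Utility

end KnowledgeSharing

end

/-!
Remove the distinguished agent from two copies of a random 2-connected topology with random inputs,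
and connect the dangling ports of the two halves to a large complete graph of fictitious agents. The
joined network is 2-connected and its size is possible, so `Λ` computes `q` on it, and by full
knowledge `q` takes the value `p` there with probability `θ = 1 / |Y|`, whatever one of the halves
looks like.

Cut the joined network between a half and everything else, and suppose that everything else is
played by the distinguished agent, who may *switch*: when the messages exchanged so far form a
given transcript, it replaces its state by one of its own choice that is compatible with this
transcript. Given the transcript the two sides of a cut are independent, so if no switch makes
`q = p` more likely than `θ`, then the state of everything else is independent of `q = p` at all
times. This is impossible: a fictitious agent eventually outputs `p` if and only if `q = p`.

So there is a profitable switch, and it is a deviation of the distinguished agent: its gain is an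
average over the topologies in which it has the degree in question. In all other topologies the
deviation follows `Λ`, whose utility is exactly `θ` in every network.
-/

open scoped ENNReal

noncomputable section

namespace KnowledgeSharing

/-! ### Discrete probability -/

section Expectation

variable {α β γ : Type*}

/-- The expectation of a nonnegative function. -/
def expect (μ : PMF α) (f : α → ℝ≥0∞) : ℝ≥0∞ := ∑' a, μ a * f a

open Classical in
/-- The Iverson bracket: one if the proposition holds and zero otherwise. -/
def iverson (P : Prop) : ℝ≥0∞ := if P then 1 else 0

/-- The probability of an event, given as a predicate. -/
def prob (μ : PMF α) (E : α → Prop) : ℝ≥0∞ := expect μ fun a => iverson (E a)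

theorem iverson_true {P : Prop} (h : P) : iverson P = 1 := if_pos h

theorem iverson_false {P : Prop} (h : ¬P) : iverson P = 0 := if_neg h

theorem iverson_le_one (P : Prop) : iverson P ≤ 1 := by unfold iverson; split <;> simp

theorem iverson_mono {P Q : Prop} (h : P → Q) : iverson P ≤ iverson Q := by
  by_cases hP : P
  · rw [iverson_true hP, iverson_true (h hP)]
  · simp [iverson_false hP]

theorem iverson_and (P Q : Prop) : iverson (P ∧ Q) = iverson P * iverson Q := by
  by_cases hP : P <;> by_cases hQ : Q <;> simp [iverson, hP, hQ]

theorem expect_pure (a : α) (f : α → ℝ≥0∞) : expect (PMF.pure a) f = f a := by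
  rw [expect, tsum_eq_single a fun b hb => by simp [PMF.pure_apply, hb]]
  simp

theorem expect_bind (μ : PMF α) (κ : α → PMF β) (f : β → ℝ≥0∞) :
    expect (μ.bind κ) f = expect μ fun a => expect (κ a) f := by
  simp only [expect, PMF.bind_apply, ← ENNReal.tsum_mul_right, ← ENNReal.tsum_mul_left, mul_assoc]
  rw [ENNReal.tsum_comm]

theorem expect_map (μ : PMF α) (g : α → β) (f : β → ℝ≥0∞) :
    expect (μ.map g) f = expect μ fun a => f (g a) := by
  simp [← PMF.bind_pure_comp, expect_bind, expect_pure]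

theorem expect_const (μ : PMF α) (c : ℝ≥0∞) : expect μ (fun _ => c) = c := by
  rw [expect, ENNReal.tsum_mul_right, PMF.tsum_coe, one_mul]

theorem expect_mono {μ : PMF α} {f g : α → ℝ≥0∞} (h : ∀ a ∈ μ.support, f a ≤ g a) :
    expect μ f ≤ expect μ g := by
  refine ENNReal.tsum_le_tsum fun a => ?_
  by_cases ha : μ a = 0
  · simp [ha]
  · gcongr
    exact h a ha

theorem expect_congr {μ : PMF α} {f g : α → ℝ≥0∞} (h : ∀ a ∈ μ.support, f a = g a) :
    expect μ f = expect μ g :=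
  le_antisymm (expect_mono fun a ha => (h a ha).le) (expect_mono fun a ha => (h a ha).ge)

theorem expect_add (μ : PMF α) (f g : α → ℝ≥0∞) :
    expect μ (fun a => f a + g a) = expect μ f + expect μ g := by
  simp only [expect, mul_add, ENNReal.tsum_add]

theorem expect_mul_const (μ : PMF α) (f : α → ℝ≥0∞) (c : ℝ≥0∞) :
    expect μ (fun a => f a * c) = expect μ f * c := by
  simp only [expect, ← mul_assoc, ENNReal.tsum_mul_right]

theorem expect_iSup {μ : PMF α} {f : ℕ → α → ℝ≥0∞} (h : ∀ a, Monotone fun n => f n a) :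
    expect μ (fun a => ⨆ n, f n a) = ⨆ n, expect μ (f n) := by
  simp only [expect, ENNReal.mul_iSup, ENNReal.tsum_eq_iSup_sum]
  rw [iSup_comm]
  refine iSup_congr fun s => ENNReal.finsetSum_iSup_of_monotone fun a m n hmn => ?_
  exact mul_le_mul_right (h a hmn) _

theorem prob_bind (μ : PMF α) (κ : α → PMF β) (E : β → Prop) :
    prob (μ.bind κ) E = expect μ fun a => prob (κ a) E :=
  expect_bind _ _ _

theorem prob_map (μ : PMF α) (g : α → β) (E : β → Prop) :
    prob (μ.map g) E = prob μ fun a => E (g a) :=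
  expect_map _ _ _

theorem prob_mono {μ : PMF α} {E F : α → Prop} (h : ∀ a ∈ μ.support, E a → F a) :
    prob μ E ≤ prob μ F :=
  expect_mono fun a ha => iverson_mono (h a ha)

theorem prob_congr {μ : PMF α} {E F : α → Prop} (h : ∀ a ∈ μ.support, E a ↔ F a) :
    prob μ E = prob μ F :=
  expect_congr fun a ha => by rw [propext (h a ha)]

theorem prob_le_one (μ : PMF α) (E : α → Prop) : prob μ E ≤ 1 :=
  (expect_mono fun _ _ => iverson_le_one _).trans (expect_const μ 1).le

theorem prob_ne_top (μ : PMF α) (E : α → Prop) : prob μ E ≠ ∞ :=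
  ((prob_le_one μ E).trans_lt ENNReal.one_lt_top).ne

theorem prob_eq_one {μ : PMF α} {E : α → Prop} (h : ∀ a ∈ μ.support, E a) : prob μ E = 1 := by
  rw [← expect_const μ 1]
  exact expect_congr fun a ha => iverson_true (h a ha)

theorem prob_and_add_prob_not_and (μ : PMF α) (C E : α → Prop) :
    prob μ (fun a => C a ∧ E a) + prob μ (fun a => ¬C a ∧ E a) = prob μ E := by
  rw [prob, prob, ← expect_add]
  refine expect_congr fun a _ => ?_
  by_cases hC : C a <;> by_cases hE : E a <;> simp [iverson, hC, hE]

theorem toOuterMeasure_eq_prob (μ : PMF α) (E : α → Prop) :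
    μ.toOuterMeasure {a | E a} = prob μ E := by
  rw [PMF.toOuterMeasure_apply]
  refine tsum_congr fun a => ?_
  by_cases h : E a <;> simp [iverson, h]

theorem bind_congr {μ : PMF α} {κ κ' : α → PMF β} (h : ∀ a ∈ μ.support, κ a = κ' a) :
    μ.bind κ = μ.bind κ' := by
  ext b
  rw [PMF.bind_apply, PMF.bind_apply]
  exact expect_congr fun a ha => by rw [h a ha]

theorem map_equiv_apply (μ : PMF α) (e : α ≃ β) (b : β) : μ.map e b = μ (e.symm b) := by
  classical
  rw [PMF.map_apply, tsum_eq_single (e.symm b) fun a ha => if_neg ?_]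
  · simp
  · rintro rfl
    simp at ha

theorem eq_of_le_of_tsum_le {f g : α → ℝ≥0∞} (hg : ∑' a, g a ≠ ∞) (hle : ∀ a, f a ≤ g a)
    (h : ∑' a, g a ≤ ∑' a, f a) (a : α) : f a = g a := by
  by_contra hne
  have hf : ∑' a, f a ≠ ∞ := ne_top_of_le_ne_top hg (ENNReal.tsum_le_tsum hle)
  exact (ENNReal.tsum_lt_tsum hf hle ((hle a).lt_of_ne hne)).not_ge h

theorem eq_of_expect_eq {μ : PMF α} {f : α → ℝ≥0∞} {c : ℝ≥0∞} (hc : c ≠ ∞)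
    (hle : ∀ a, f a ≤ c) (h : expect μ f = c) {a : α} (ha : a ∈ μ.support) : f a = c := by
  have hconst : ∑' a, μ a * c = c := expect_const μ c
  refine (ENNReal.mul_right_inj ha (μ.apply_ne_top a)).1 (eq_of_le_of_tsum_le
    (g := fun a => μ a * c) (by rwa [hconst]) (fun a => mul_le_mul_right (hle a) _) ?_ a)
  rw [hconst]
  exact h.ge

theorem iSup_prob_le_iSup_prob {μ : ℕ → PMF α} {C E E' : α → Prop}
    (hCmono : Monotone fun t => prob (μ t) C) (hEmono : Monotone fun t => prob (μ t) E)
    (hC : ⨆ t, prob (μ t) C = 1) (h : ∀ t, ∀ a ∈ (μ t).support, C a → E a → E' a) :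
    ⨆ t, prob (μ t) E ≤ ⨆ t, prob (μ t) E' := by
  have hle : ∀ t, prob (μ t) E + prob (μ t) C ≤ prob (μ t) E' + 1 := fun t => by
    rw [← expect_const (μ t) 1, prob, prob, prob, ← expect_add, ← expect_add]
    refine expect_mono fun a ha => ?_
    by_cases hCa : C a
    · exact add_le_add (iverson_mono (h t a ha hCa)) (iverson_le_one _)
    · rw [iverson_false hCa, add_zero]
      exact (iverson_le_one _).trans le_add_self
  rw [← ENNReal.add_le_add_iff_right ENNReal.one_ne_top]
  calc (⨆ t, prob (μ t) E) + 1 = ⨆ t, (prob (μ t) E + prob (μ t) C) := by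
        rw [← hC, ENNReal.iSup_add_iSup_of_monotone hEmono hCmono]
    _ ≤ ⨆ t, (prob (μ t) E' + 1) := iSup_mono hle
    _ = (⨆ t, prob (μ t) E') + 1 := (ENNReal.iSup_add _).symm

/-- The value of `f` carries no information on the event `E`. -/
def Uninformative (μ : PMF α) (f : α → β) (E : α → Prop) : Prop :=
  ∀ h : β → ℝ≥0∞, expect μ (fun a => h (f a) * iverson (E a)) = prob μ E * expect μ fun a => h (f a)

theorem Uninformative.comp {μ : PMF α} {f : α → β} {E : α → Prop} (hf : Uninformative μ f E)
    (g : β → γ) : Uninformative μ (fun a => g (f a)) E :=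
  fun h => hf fun b => h (g b)

theorem Uninformative.prob_and {μ : PMF α} {f : α → β} {E : α → Prop}
    (hf : Uninformative μ f E) (C : β → Prop) :
    prob μ (fun a => C (f a) ∧ E a) = prob μ E * prob μ fun a => C (f a) := by
  simpa only [prob, iverson_and] using hf fun b => iverson (C b)

theorem uninformative_map (μ : PMF α) (g : α → β) (f : β → γ) (E : β → Prop) :
    Uninformative (μ.map g) f E ↔ Uninformative μ (fun a => f (g a)) fun a => E (g a) := by
  simp only [Uninformative, expect_map, prob_map]

theorem uninformative_of_forall_eq {μ : PMF α} {f : α → β} {b : β} (hf : ∀ a ∈ μ.support, f a = b)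
    (E : α → Prop) : Uninformative μ f E := by
  intro h
  have hconst : expect μ (fun a => h (f a)) = h b :=
    (expect_congr fun a ha => by rw [hf a ha]).trans (expect_const μ _)
  rw [hconst, prob, ← expect_mul_const]
  exact expect_congr fun a ha => by rw [hf a ha, mul_comm]

theorem Uninformative.bind {μ : PMF α} {f : α → γ} {E : α → Prop} (hf : Uninformative μ f E)
    {κ : α → PMF β} {f' : β → γ} {E' : β → Prop} (hf' : ∀ a, ∀ b ∈ (κ a).support, f' b = f a)
    (hE' : ∀ a, ∀ b ∈ (κ a).support, E' b ↔ E a) : Uninformative (μ.bind κ) f' E' := by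
  have hstep : ∀ (F : γ → Prop → ℝ≥0∞) a,
      expect (κ a) (fun b => F (f' b) (E' b)) = F (f a) (E a) := fun F a => by
    rw [← expect_const (κ a) (F (f a) (E a))]
    exact expect_congr fun b hb => by rw [hf' a b hb, propext (hE' a b hb)]
  intro h
  rw [prob, expect_bind, expect_bind, expect_bind]
  simp only [hstep fun c P => h c * iverson P, hstep fun _ P => iverson P, hstep fun c _ => h c]
  exact hf h

end Expectation

/-! ### Independent draws -/

section Product

variable {α β γ δ : Type*}

/-- The law of a pair of independent draws. -/
def pmfProd (μ : PMF α) (ν : PMF β) : PMF (α × β) := μ.bind fun a => ν.map (Prod.mk a)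

theorem pmfProd_apply (μ : PMF α) (ν : PMF β) (x : α × β) : pmfProd μ ν x = μ x.1 * ν x.2 := by
  classical
  obtain ⟨a, b⟩ := x
  rw [pmfProd, PMF.bind_apply, tsum_eq_single a fun a' ha => ?_]
  · rw [PMF.map_apply, tsum_eq_single b fun b' hb => by simp [hb.symm]]
    simp
  · rw [PMF.map_apply, ENNReal.tsum_eq_zero.2 fun b' => by simp [ha.symm], mul_zero]

theorem expect_pmfProd (μ : PMF α) (ν : PMF β) (f : α × β → ℝ≥0∞) :
    expect (pmfProd μ ν) f = expect μ fun a => expect ν fun b => f (a, b) := by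
  simp only [pmfProd, expect_bind, expect_map]

theorem mem_support_pmfProd {μ : PMF α} {ν : PMF β} {x : α × β} :
    x ∈ (pmfProd μ ν).support ↔ x.1 ∈ μ.support ∧ x.2 ∈ ν.support := by
  simp only [PMF.mem_support_iff, pmfProd_apply, mul_ne_zero_iff]

theorem pmfProd_map (μ : PMF α) (ν : PMF β) (f : α → γ) (g : β → δ) :
    (pmfProd μ ν).map (Prod.map f g) = pmfProd (μ.map f) (ν.map g) := by
  simp only [pmfProd, PMF.map_bind, PMF.bind_map, PMF.map_comp, Function.comp_def, Prod.map_apply]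

theorem pmfProd_map_swap (μ : PMF α) (ν : PMF β) :
    (pmfProd μ ν).map Prod.swap = pmfProd ν μ := by
  ext x
  rw [← Equiv.coe_prodComm, map_equiv_apply, pmfProd_apply, pmfProd_apply]
  exact mul_comm _ _

/-- The law of a dependent pair whose second entry is drawn from a law depending on the first. -/
def pmfSigma {T : α → Type*} (μ : PMF α) (κ : ∀ a, PMF (T a)) : PMF (Σ a, T a) :=
  μ.bind fun a => (κ a).map (Sigma.mk a)

theorem expect_pmfSigma {T : α → Type*} (μ : PMF α) (κ : ∀ a, PMF (T a))
    (f : (Σ a, T a) → ℝ≥0∞) :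
    expect (pmfSigma μ κ) f = expect μ fun a => expect (κ a) fun b => f ⟨a, b⟩ := by
  simp only [pmfSigma, expect_bind, expect_map]

theorem tsum_pi_fin_prod : ∀ {n : ℕ} {α : Fin n → Type*} (f : ∀ i, α i → ℝ≥0∞),
    ∑' c : (∀ i, α i), ∏ i, f i (c i) = ∏ i, ∑' a, f i a
  | 0, α, f => by
      rw [tsum_eq_single (fun i => i.elim0) fun c hc => (hc (funext fun i => i.elim0)).elim]
      simp
  | n + 1, α, f => by
      rw [← (Fin.consEquiv α).tsum_eq, ENNReal.tsum_prod']
      simp only [Fin.consEquiv, Equiv.coe_fn_mk, Fin.prod_univ_succ, Fin.cons_zero, Fin.cons_succ,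
        ENNReal.tsum_mul_left, tsum_pi_fin_prod fun i => f i.succ, ENNReal.tsum_mul_right]

variable {ι : Type*} [Fintype ι] {S S' : ι → Type*}

theorem tsum_pi_prod (f : ∀ i, S i → ℝ≥0∞) :
    ∑' c : (∀ i, S i), ∏ i, f i (c i) = ∏ i, ∑' a, f i a := by
  let e := (Fintype.equivFin ι).symm
  rw [← Fintype.prod_equiv e _ _ fun k => rfl, ← tsum_pi_fin_prod fun k => f (e k),
    ← (Equiv.piCongrLeft S e).tsum_eq]
  refine tsum_congr fun c => (Fintype.prod_equiv e _ _ fun k => ?_).symm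
  rw [Equiv.piCongrLeft_apply_apply]

/-- The joint law of independent draws indexed by a finite type. -/
def indep (P : ∀ i, PMF (S i)) : PMF (∀ i, S i) :=
  ⟨fun c => ∏ i, P i (c i), by
    simpa only [tsum_pi_prod, PMF.tsum_coe, Finset.prod_const_one] using
      (ENNReal.summable (f := fun c : ∀ i, S i => ∏ i, P i (c i))).hasSum⟩

theorem indep_apply (P : ∀ i, PMF (S i)) (c : ∀ i, S i) : indep P c = ∏ i, P i (c i) := rfl

theorem mem_support_of_mem_support_indep {P : ∀ i, PMF (S i)} {c : ∀ i, S i}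
    (hc : c ∈ (indep P).support) (i : ι) : c i ∈ (P i).support :=
  Finset.prod_ne_zero_iff.1 hc i (Finset.mem_univ i)

theorem indep_bind (P : ∀ i, PMF (S i)) (κ : ∀ i, S i → PMF (S' i)) :
    (indep P).bind (fun c => indep fun i => κ i (c i)) = indep fun i => (P i).bind (κ i) := by
  ext c'
  simp only [PMF.bind_apply, indep_apply, ← Finset.prod_mul_distrib]
  exact tsum_pi_prod fun i a => P i a * κ i a (c' i)

theorem indep_pure (c : ∀ i, S i) : indep (fun i => PMF.pure (c i)) = PMF.pure c := by
  classical
  ext c'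
  rw [indep_apply, PMF.pure_apply]
  split_ifs with h
  · simp [h]
  · obtain ⟨i, hi⟩ := Function.ne_iff.1 h
    exact Finset.prod_eq_zero (Finset.mem_univ i) (by rw [PMF.pure_apply, if_neg hi])

theorem indep_map (P : ∀ i, PMF (S i)) (f : ∀ i, S i → S' i) :
    (indep P).map (fun c i => f i (c i)) = indep fun i => (P i).map (f i) := by
  rw [← PMF.bind_pure_comp]
  simp only [← PMF.bind_pure_comp]
  rw [← indep_bind]
  exact bind_congr fun c _ => (indep_pure _).symm

theorem indep_pmfSigma {T : ∀ i, S i → Type*} (P : ∀ i, PMF (S i)) (κ : ∀ i a, PMF (T i a)) :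
    indep (fun i => pmfSigma (P i) (κ i)) =
      (pmfSigma (indep P) fun c => indep fun i => κ i (c i)).map fun x i => ⟨x.1 i, x.2 i⟩ := by
  simp only [pmfSigma, PMF.map_bind, PMF.map_comp, Function.comp_def]
  rw [← indep_bind]
  exact bind_congr fun c _ => (indep_map _ fun i => Sigma.mk (c i)).symm

theorem indep_map_piSplitAt [DecidableEq ι] (P : ∀ i, PMF (S i)) (i : ι) :
    (indep P).map (Equiv.piSplitAt i S) =
      pmfProd (P i) (indep fun j : {j // j ≠ i} => P j) := by
  ext x
  rw [map_equiv_apply, pmfProd_apply, indep_apply, indep_apply,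
    Fintype.prod_eq_mul_prod_subtype_ne _ i]
  congr 1
  · simp
  · exact Finset.prod_congr rfl fun j _ => by simp [j.2]

theorem expect_indep_update [DecidableEq ι] (P : ∀ i, PMF (S i)) (i : ι)
    (F : (∀ i, S i) → ℝ≥0∞) :
    expect (indep P) F =
      expect (indep P) fun c => expect (P i) fun a => F (Function.update c i a) := by
  have hsplit : indep P = (pmfProd (P i) (indep fun j : {j // j ≠ i} => P j)).map
      (Equiv.piSplitAt i S).symm := by
    rw [← indep_map_piSplitAt, PMF.map_comp, Equiv.symm_comp_self, PMF.map_id]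
  have hupdate : ∀ a b (r : ∀ j : {j // j ≠ i}, S j),
      Function.update ((Equiv.piSplitAt i S).symm (b, r)) i a =
        (Equiv.piSplitAt i S).symm (a, r) := fun a b r => by
    funext j
    by_cases hj : j = i
    · subst hj
      simp
    · simp [hj]
  simp only [hsplit, expect_map, expect_pmfProd, hupdate, expect_const]
  simp only [expect, ← ENNReal.tsum_mul_left]
  rw [ENNReal.tsum_comm]
  exact tsum_congr fun r => tsum_congr fun a => mul_left_comm _ _ _

theorem indep_map_sumArrow {κ : Type*} [Fintype κ] (P : ι ⊕ κ → PMF α) :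
    (indep P).map (Equiv.sumArrowEquivProdArrow ι κ α) =
      pmfProd (indep fun i => P (.inl i)) (indep fun k => P (.inr k)) := by
  ext x
  rw [map_equiv_apply, pmfProd_apply, indep_apply, Fintype.prod_sum_type]
  rfl

theorem indep_map_curry {V : ι → Type*} [∀ i, Fintype (V i)] (P : (Σ i, V i) → PMF α) :
    (indep P).map (Equiv.piCurry fun _ _ => α) = indep fun i => indep fun v => P ⟨i, v⟩ := by
  ext x
  rw [map_equiv_apply, indep_apply, Fintype.prod_sigma]
  rfl

theorem indep_map_arrowCongr {κ : Type*} [Fintype κ] (P : ι → PMF α) (e : ι ≃ κ) :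
    (indep P).map (fun c k => c (e.symm k)) = indep fun k => P (e.symm k) := by
  ext x
  change (indep P).map (e.arrowCongr (Equiv.refl α)) x = _
  rw [map_equiv_apply, indep_apply, indep_apply]
  exact Fintype.prod_equiv e _ _ fun i => by simp

theorem uniformOfFintype_pi_eq_indep [DecidableEq ι] [Fintype α] [Nonempty α] :
    PMF.uniformOfFintype (ι → α) = indep fun _ => PMF.uniformOfFintype α := by
  ext x
  simp [indep_apply, ENNReal.inv_pow]

end Product

/-! ### Markov chains -/

section Chain

variable {α β : Type*}

/-- The law after `t` steps of the Markov chain with transition kernel `κ` and initial law `μ`. -/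
def chain (κ : α → PMF α) (μ : PMF α) : ℕ → PMF α
  | 0 => μ
  | t + 1 => (chain κ μ t).bind κ

theorem chain_map {κ : α → PMF α} {κ' : β → PMF β} {f : α → β}
    (h : ∀ a, (κ a).map f = κ' (f a)) (μ : PMF α) (t : ℕ) :
    (chain κ μ t).map f = chain κ' (μ.map f) t := by
  induction t with
  | zero => rfl
  | succ t ih =>
    rw [chain, chain, ← ih, PMF.map_bind, PMF.bind_map]
    exact bind_congr fun a _ => h a

theorem chain_add (κ : α → PMF α) (μ : PMF α) (s t : ℕ) :
    chain κ μ (s + t) = chain κ (chain κ μ s) t := by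
  induction t with
  | zero => rfl
  | succ t ih => rw [← add_assoc, chain, chain, ih]

theorem chain_bind (κ : α → PMF α) (ν : PMF β) (μ : β → PMF α) (t : ℕ) :
    chain κ (ν.bind μ) t = ν.bind fun b => chain κ (μ b) t := by
  induction t with
  | zero => rfl
  | succ t ih => simp only [chain, ih, PMF.bind_bind]

theorem chain_eq_bind_pure (κ : α → PMF α) (μ : PMF α) (t : ℕ) :
    chain κ μ t = μ.bind fun a => chain κ (PMF.pure a) t := by
  rw [← chain_bind, PMF.bind_pure]

/-- An event that the Markov chain with kernel `κ` never leaves. -/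
def Persistent (κ : α → PMF α) (E : α → Prop) : Prop := ∀ a, E a → ∀ b ∈ (κ a).support, E b

theorem Persistent.comap {κ : α → PMF α} {κ' : β → PMF β} {E : β → Prop} (hE : Persistent κ' E)
    {f : α → β} (h : ∀ a, (κ a).map f = κ' (f a)) : Persistent κ fun a => E (f a) :=
  fun a ha b hb => hE _ ha _ <| by
    rw [← h]
    exact (PMF.mem_support_map_iff _ _ _).2 ⟨b, hb, rfl⟩

theorem Persistent.of_mem_support_chain {κ : α → PMF α} {E : α → Prop} (hE : Persistent κ E)
    {a b : α} (ha : E a) {t : ℕ} (hb : b ∈ (chain κ (PMF.pure a) t).support) : E b := by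
  induction t generalizing b with
  | zero => rwa [(PMF.mem_support_pure_iff _ _).1 hb]
  | succ t ih =>
    obtain ⟨c, hc, hb⟩ := (PMF.mem_support_bind_iff _ _ _).1 hb
    exact hE c (ih hc) b hb

theorem Persistent.prob_chain_mono {κ : α → PMF α} {E : α → Prop} (hE : Persistent κ E)
    (μ : PMF α) : Monotone fun t => prob (chain κ μ t) E := by
  refine monotone_nat_of_le_succ fun t => ?_
  change _ ≤ prob ((chain κ μ t).bind κ) E
  rw [prob_bind]
  refine expect_mono fun a _ => ?_
  by_cases ha : E a
  · rw [iverson_true ha, prob_eq_one (hE a ha)]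
  · simp [iverson_false ha]

theorem Persistent.iSup_prob_chain {κ : α → PMF α} {E : α → Prop} (hE : Persistent κ E)
    (μ : PMF α) :
    ⨆ t, prob (chain κ μ t) E = expect μ fun a => ⨆ t, prob (chain κ (PMF.pure a) t) E := by
  rw [expect_iSup fun a => hE.prob_chain_mono _]
  exact iSup_congr fun t => by rw [chain_eq_bind_pure, prob_bind]

theorem Persistent.iSup_prob_chain_pure_eq_one {κ : α → PMF α} {E : α → Prop}
    (hE : Persistent κ E) {μ : PMF α} (h : ⨆ t, prob (chain κ μ t) E = 1) {s : ℕ} {a : α}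
    (ha : a ∈ (chain κ μ s).support) : ⨆ t, prob (chain κ (PMF.pure a) t) E = 1 := by
  have hs : ⨆ t, prob (chain κ (chain κ μ s) t) E = 1 := by
    simp only [← chain_add, add_comm s, (hE.prob_chain_mono μ).iSup_nat_add s, h]
  rw [hE.iSup_prob_chain] at hs
  exact eq_of_expect_eq ENNReal.one_ne_top (fun b => iSup_le fun t => prob_le_one _ _) hs ha

end Chain

/-! ### Interacting parties -/

/-- A randomised state machine that in every round emits a message in `O`, receives a message
in `I` and draws its next state. -/
structure Party (S I O : Type*) where
  init : PMF S
  out : S → O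
  step : S → I → PMF S

namespace Party

variable {S S' Z Z' I O : Type*}

/-- One simultaneous round of two parties that talk to each other. -/
def round (A : Party S I O) (B : Party Z O I) (x : S × Z) : PMF (S × Z) :=
  pmfProd (A.step x.1 (B.out x.2)) (B.step x.2 (A.out x.1))

/-- The law of the pair of states after `t` rounds. -/
def law (A : Party S I O) (B : Party Z O I) : ℕ → PMF (S × Z) :=
  chain (round A B) (pmfProd A.init B.init)

/-- A map of states under which one party behaves as the other. -/
structure Hom (A : Party S I O) (A' : Party S' I O) where
  map : S → S'
  init : A.init.map map = A'.init
  out : ∀ s, A'.out (map s) = A.out s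
  step : ∀ s i, (A.step s i).map map = A'.step (map s) i

/-- The identity morphism. -/
def Hom.id (A : Party S I O) : Hom A A :=
  ⟨_root_.id, PMF.map_id _, fun _ => rfl, fun _ _ => PMF.map_id _⟩

section Morphism

variable {A : Party S I O} {A' : Party S' I O} {B : Party Z O I} {B' : Party Z' O I}

theorem round_map (f : Hom A A') (g : Hom B B') (x : S × Z) :
    (round A B x).map (Prod.map f.map g.map) = round A' B' (Prod.map f.map g.map x) := by
  simp only [round, pmfProd_map, f.step, g.step, Prod.map_fst, Prod.map_snd, f.out, g.out]

theorem law_map (f : Hom A A') (g : Hom B B') (t : ℕ) :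
    (law A B t).map (Prod.map f.map g.map) = law A' B' t := by
  rw [law, chain_map (round_map f g), pmfProd_map, f.init, g.init, law]

end Morphism

/-- The value given out by a party under `o` is never revised. -/
def Irrevocable {V : Type*} (A : Party S I O) (o : S → Option V) : Prop :=
  ∀ s i v, o s = some v → ∀ s' ∈ (A.step s i).support, o s' = some v

section Record

/-- The party that in addition remembers the messages it has sent and received, latest first. -/
def record (A : Party S I O) : Party (S × List (O × I)) I O where
  init := A.init.map fun s => (s, [])
  out s := A.out s.1
  step s i := (A.step s.1 i).map fun s' => (s', (A.out s.1, i) :: s.2)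

/-- Forgetting the record. -/
def recordHom (A : Party S I O) : Hom A.record A where
  map := Prod.fst
  init := (PMF.map_comp _ _ _).trans (PMF.map_id _)
  out _ := rfl
  step _ _ := (PMF.map_comp _ _ _).trans (PMF.map_id _)

variable (A : Party S I O) (B : Party Z O I)

theorem law_record_map (t : ℕ) :
    (law A.record B t).map (fun g => (g.1.1, g.2)) = law A B t :=
  law_map (recordHom A) (Hom.id B) t

theorem law_record_succ (t : ℕ) :
    law A.record B (t + 1) = (law A.record B t).bind fun g =>
      (round A B (g.1.1, g.2)).map fun x => ((x.1, (A.out g.1.1, B.out g.2) :: g.1.2), x.2) := by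
  refine bind_congr fun g _ => ?_
  simp only [round, record, pmfProd, PMF.map_bind, PMF.bind_map, PMF.map_comp, Function.comp_def]

variable {A B}

theorem length_record {t : ℕ} {g : (S × List (O × I)) × Z}
    (hg : g ∈ (law A.record B t).support) : g.1.2.length = t := by
  induction t generalizing g with
  | zero =>
    obtain ⟨s, hs, hg⟩ := (PMF.mem_support_bind_iff _ _ _).1 hg
    obtain ⟨s', -, rfl⟩ := (PMF.mem_support_map_iff _ _ _).1 hs
    obtain ⟨z, -, rfl⟩ := (PMF.mem_support_map_iff _ _ _).1 hg
    rfl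
  | succ t ih =>
    rw [law_record_succ] at hg
    obtain ⟨g', hg', hg⟩ := (PMF.mem_support_bind_iff _ _ _).1 hg
    obtain ⟨x, -, rfl⟩ := (PMF.mem_support_map_iff _ _ _).1 hg
    simp [ih hg']

end Record

end Party

/-! ### Switching behind a transcript -/

section IndepGiven

variable {S C Z : Type*} {μ : PMF ((S × C) × Z)}

/-- The first and the last component are independent given the middle one. -/
def IndepGiven (μ : PMF ((S × C) × Z)) : Prop :=
  ∀ c, ∃ (a : S → ℝ≥0∞) (b : Z → ℝ≥0∞), ∀ s z, μ ((s, c), z) = a s * b z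

theorem IndepGiven.mem_support (hμ : IndepGiven μ) {c : C} {s s' : S} {z z' : Z}
    (h : ((s, c), z) ∈ μ.support) (h' : ((s', c), z') ∈ μ.support) :
    ((s, c), z') ∈ μ.support := by
  obtain ⟨a, b, hab⟩ := hμ c
  rw [PMF.mem_support_iff, hab] at h h' ⊢
  exact mul_ne_zero (left_ne_zero_of_mul h) (right_ne_zero_of_mul h')

theorem expect_eq_tsum_middle (μ : PMF ((S × C) × Z)) (f : (S × C) × Z → ℝ≥0∞) :
    expect μ f = ∑' (c) (z) (s), μ ((s, c), z) * f ((s, c), z) := by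
  rw [expect, ENNReal.tsum_prod', ENNReal.tsum_prod', ENNReal.tsum_comm]
  exact tsum_congr fun c => ENNReal.tsum_comm

theorem prob_middle_eq_and (μ : PMF ((S × C) × Z)) (c : C) (E : S → Z → Prop) :
    prob μ (fun g => g.1.2 = c ∧ E g.1.1 g.2) =
      ∑' (z) (s), μ ((s, c), z) * iverson (E s z) := by
  rw [prob, expect_eq_tsum_middle, tsum_eq_single c fun c' hc' => by simp [hc', iverson]]
  simp

theorem prob_middle_eq (μ : PMF ((S × C) × Z)) (c : C) :
    prob μ (fun g => g.1.2 = c) = ∑' (z) (s), μ ((s, c), z) := by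
  simpa [iverson] using prob_middle_eq_and μ c fun _ _ => True

open Classical in
/-- The last component after it has been replaced by `z`, provided the middle one is `c`. -/
def redirect (c : C) (z : Z) (g : (S × C) × Z) : Z := if g.1.2 = c then z else g.2

theorem prob_middle_eq_and_le_of_prob_redirect_le {E : S → Z → Prop} {c : C} {z : Z}
    (h : prob μ (fun g => E g.1.1 (redirect c z g)) ≤ prob μ fun g => E g.1.1 g.2) :
    prob μ (fun g => g.1.2 = c ∧ E g.1.1 z) ≤ prob μ fun g => g.1.2 = c ∧ E g.1.1 g.2 := by
  rw [← prob_and_add_prob_not_and μ (fun g => g.1.2 = c),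
    ← prob_and_add_prob_not_and μ (fun g => g.1.2 = c) fun g => E g.1.1 g.2] at h
  have hswitch : prob μ (fun g => g.1.2 = c ∧ E g.1.1 (redirect c z g)) =
      prob μ fun g => g.1.2 = c ∧ E g.1.1 z :=
    prob_congr fun g _ => and_congr_right fun hc => by rw [redirect, if_pos hc]
  have hkeep : prob μ (fun g => ¬g.1.2 = c ∧ E g.1.1 (redirect c z g)) =
      prob μ fun g => ¬g.1.2 = c ∧ E g.1.1 g.2 :=
    prob_congr fun g _ => and_congr_right fun hc => by rw [redirect, if_neg hc]
  rw [hswitch, hkeep] at h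
  exact (ENNReal.add_le_add_iff_right (prob_ne_top _ _)).1 h

theorem IndepGiven.mul_prob_middle_eq_and (hμ : IndepGiven μ) (E : S → Z → Prop) (c : C) (z : Z) :
    (∑' s, μ ((s, c), z)) * prob μ (fun g => g.1.2 = c ∧ E g.1.1 z) =
      prob μ (fun g => g.1.2 = c) * ∑' s, μ ((s, c), z) * iverson (E s z) := by
  obtain ⟨a, b, hab⟩ := hμ c
  rw [prob_middle_eq, prob_middle_eq_and μ c fun s _ => E s z]
  simp only [hab, mul_right_comm _ (b _), ENNReal.tsum_mul_right, ENNReal.tsum_mul_left]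
  ring

/-- At no value of the last component is `E` more likely than on average, hence it is equally
likely at all of them. -/
theorem IndepGiven.tsum_eq_of_prob_redirect_le (hμ : IndepGiven μ) {E : S → Z → Prop}
    (hE : Uninformative μ (fun g => g.1.2) fun g => E g.1.1 g.2)
    (hno : ∀ c z s, ((s, c), z) ∈ μ.support →
      prob μ (fun g => E g.1.1 (redirect c z g)) ≤ prob μ fun g => E g.1.1 g.2) (c : C) (z : Z) :
    ∑' s, μ ((s, c), z) * iverson (E s z) =
      prob μ (fun g => E g.1.1 g.2) * ∑' s, μ ((s, c), z) := by
  set θ := prob μ fun g => E g.1.1 g.2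
  have hcE : prob μ (fun g => g.1.2 = c ∧ E g.1.1 g.2) = θ * prob μ fun g => g.1.2 = c :=
    hE.prob_and fun c' => c' = c
  refine eq_of_le_of_tsum_le (f := fun z => ∑' s, μ ((s, c), z) * iverson (E s z))
    (g := fun z => θ * ∑' s, μ ((s, c), z)) ?_ (fun z => ?_) ?_ z
  · rw [ENNReal.tsum_mul_left, ← prob_middle_eq]
    exact ENNReal.mul_ne_top (prob_ne_top _ _) (prob_ne_top _ _)
  · by_cases hz : ∃ s, ((s, c), z) ∈ μ.support
    · obtain ⟨s, hs⟩ := hz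
      have hc0 : prob μ (fun g => g.1.2 = c) ≠ 0 := fun h => by
        rw [prob_middle_eq, ENNReal.tsum_eq_zero] at h
        exact hs (ENNReal.tsum_eq_zero.1 (h z) s)
      rw [← ENNReal.mul_le_mul_iff_right hc0 (prob_ne_top _ _), ← hμ.mul_prob_middle_eq_and]
      calc _ ≤ (∑' s, μ ((s, c), z)) * (θ * prob μ fun g => g.1.2 = c) := by
            rw [← hcE]
            gcongr
            exact prob_middle_eq_and_le_of_prob_redirect_le (hno c z s hs)
        _ = _ := by ring
    · have h0 : ∀ s, μ ((s, c), z) = 0 := fun s => by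
        simpa using not_exists.1 hz s
      simp [h0]
  · rw [ENNReal.tsum_mul_left, ← prob_middle_eq, ← hcE, prob_middle_eq_and]

theorem IndepGiven.uninformative_of_prob_redirect_le (hμ : IndepGiven μ) {E : S → Z → Prop}
    (hE : Uninformative μ (fun g => g.1.2) fun g => E g.1.1 g.2)
    (hno : ∀ c z s, ((s, c), z) ∈ μ.support →
      prob μ (fun g => E g.1.1 (redirect c z g)) ≤ prob μ fun g => E g.1.1 g.2) :
    Uninformative μ (fun g => g.2) fun g => E g.1.1 g.2 := by
  intro h
  rw [expect_eq_tsum_middle, expect_eq_tsum_middle, ← ENNReal.tsum_mul_left]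
  refine tsum_congr fun c => ?_
  rw [← ENNReal.tsum_mul_left]
  refine tsum_congr fun z => ?_
  simp only [mul_left_comm _ (h z), mul_comm _ (h z), ENNReal.tsum_mul_left,
    hμ.tsum_eq_of_prob_redirect_le hE hno c z]

end IndepGiven

namespace Party

variable {S S' Z Z' I O : Type*}

theorem prod_map_mk_apply {α β γ : Type*} [DecidableEq β] (μ : PMF α) (ν : PMF γ) (b : β)
    (x : (α × β) × γ) :
    (pmfProd μ ν).map (fun y => ((y.1, b), y.2)) x =
      if x.1.2 = b then μ x.1.1 * ν x.2 else 0 := by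
  classical
  obtain ⟨⟨a, b'⟩, c⟩ := x
  rw [PMF.map_apply, tsum_eq_single (a, c)]
  · simp [pmfProd_apply]
  · rintro ⟨a', c'⟩ hne
    refine if_neg fun h => hne ?_
    simp only [Prod.mk.injEq] at h
    rw [h.1.1, h.2]

open Classical in
theorem law_record_succ_cons (A : Party S I O) (B : Party Z O I) (t : ℕ) (s' : S) (z' : Z)
    (o : O) (i : I) (c : List (O × I)) :
    law A.record B (t + 1) ((s', (o, i) :: c), z') =
      ∑' (s) (z), if A.out s = o ∧ B.out z = i then
        law A.record B t ((s, c), z) * (A.step s i s' * B.step z o z') else 0 := by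
  have hround : ∀ s c' z, law A.record B t ((s, c'), z) *
        (round A B (s, z)).map (fun x => ((x.1, (A.out s, B.out z) :: c'), x.2))
          ((s', (o, i) :: c), z') =
      if c' = c then if A.out s = o ∧ B.out z = i then
        law A.record B t ((s, c'), z) * (A.step s i s' * B.step z o z') else 0 else 0 :=
    fun s c' z => by
      rw [round, prod_map_mk_apply]
      by_cases hc : c' = c
      · by_cases h : A.out s = o ∧ B.out z = i
        · simp [hc, h.1, h.2]
        · simp [hc, h, eq_comm (a := o), eq_comm (a := i)]
      · simp [hc, Ne.symm hc]
  rw [law_record_succ, PMF.bind_apply, ENNReal.tsum_prod', ENNReal.tsum_prod']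
  refine tsum_congr fun s => ?_
  simp only [hround]
  rw [tsum_eq_single c fun c' hc' => by simp [hc']]
  simp only [if_true]

theorem indepGiven_record (A : Party S I O) (B : Party Z O I) (t : ℕ) :
    IndepGiven (law A.record B t) := by
  classical
  induction t with
  | zero =>
    intro c
    have hlaw : law A.record B 0 = (pmfProd A.init B.init).map fun x => ((x.1, []), x.2) := by
      simp only [law, chain, record, pmfProd, PMF.map_bind, PMF.bind_map, PMF.map_comp,
        Function.comp_def]
    refine ⟨fun s => if c = [] then A.init s else 0, B.init, fun s z => ?_⟩
    rw [hlaw, prod_map_mk_apply]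
    simp
  | succ t ih =>
    rintro (_ | ⟨⟨o, i⟩, c⟩)
    · refine ⟨0, 0, fun s z => ?_⟩
      rw [Pi.zero_apply, zero_mul, PMF.apply_eq_zero_iff]
      exact fun h => by simpa using length_record h
    obtain ⟨a, b, hab⟩ := ih c
    refine ⟨fun s' => ∑' s, if A.out s = o then a s * A.step s i s' else 0,
      fun z' => ∑' z, if B.out z = i then b z * B.step z o z' else 0, fun s' z' => ?_⟩
    rw [law_record_succ_cons, ← ENNReal.tsum_mul_right]
    refine tsum_congr fun s => ?_
    rw [← ENNReal.tsum_mul_left]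
    refine tsum_congr fun z => ?_
    by_cases ho : A.out s = o <;> by_cases hi : B.out z = i
    · simp only [hab, ho, hi, and_self, if_true]
      ring
    all_goals simp [ho, hi]

end Party

namespace Party

variable {S S' Z Z' I O : Type*}

section Switch

open Classical in
/-- The state of `B.switch c z₀` whose simulated state is `z` and whose transcript is `l`. -/
def switchState (c : List (O × I)) (z₀ z : Z) (l : List (O × I)) : (Z × List (O × I)) ⊕ Z :=
  if l.length = c.length then .inr (if l = c then z₀ else z) else .inl (z, l)

/-- The party that behaves as `B` and keeps a transcript for as many rounds as `c` has entries;
if the transcript is then `c`, it continues from the state `z₀` instead of its own. As in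
`Party.record`, transcripts list the latest round first, as seen by the opposite party. -/
def switch (B : Party Z O I) (c : List (O × I)) (z₀ : Z) :
    Party ((Z × List (O × I)) ⊕ Z) O I where
  init := B.init.map fun z => switchState c z₀ z []
  out := Sum.elim (fun y => B.out y.1) B.out
  step
    | .inl (z, l), o => (B.step z o).map fun z' => switchState c z₀ z' ((o, B.out z) :: l)
    | .inr z, o => (B.step z o).map .inr

variable (A : Party S I O) (B : Party Z O I) (c : List (O × I)) (z₀ : Z)

theorem round_switch_inl (s : S) (z : Z) (l : List (O × I)) :
    round A (B.switch c z₀) (s, .inl (z, l)) =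
      (round A B (s, z)).map fun x => (x.1, switchState c z₀ x.2 ((A.out s, B.out z) :: l)) := by
  simp only [round, switch, pmfProd, Sum.elim_inl, PMF.map_bind, PMF.map_comp, Function.comp_def]

theorem round_switch_inr (x : S × Z) :
    (round A B x).map (Prod.map id .inr) = round A (B.switch c z₀) (Prod.map id .inr x) := by
  simp only [round, switch, pmfProd, Prod.map_fst, Prod.map_snd, id, Sum.elim_inr, PMF.map_bind,
    PMF.map_comp, Function.comp_def, Prod.map_apply]

theorem law_switch {t : ℕ} (ht : t ≤ c.length) :
    law A (B.switch c z₀) t =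
      (law A.record B t).map fun g => (g.1.1, switchState c z₀ g.2 g.1.2) := by
  induction t with
  | zero =>
    simp only [law, chain, record, switch, pmfProd, PMF.map_bind, PMF.bind_map, PMF.map_comp,
      Function.comp_def]
  | succ t ih =>
    rw [law_record_succ, PMF.map_bind, law, chain, ← law, ih (Nat.le_of_succ_le ht), PMF.bind_map]
    refine bind_congr fun g hg => ?_
    have hne : g.1.2.length ≠ c.length := by
      rw [length_record hg]
      exact (Nat.lt_of_succ_le ht).ne
    rw [Function.comp_apply, switchState, if_neg hne, round_switch_inl, PMF.map_comp]
    rfl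

theorem law_switch_add (t : ℕ) :
    law A (B.switch c z₀) (c.length + t) =
      (chain (round A B) ((law A.record B c.length).map fun g => (g.1.1, redirect c z₀ g)) t).map
        (Prod.map id .inr) := by
  rw [law, chain_add, chain_map (round_switch_inr A B c z₀), ← law, law_switch _ _ _ _ le_rfl,
    PMF.map_comp]
  congr 1
  refine bind_congr fun g hg => ?_
  simp only [Function.comp_apply, Prod.map_apply, switchState, if_pos (length_record hg), redirect,
    id]
  congr

variable {A B c z₀}

theorem Irrevocable.switch {V : Type*} {o : Z → Option V} (h : B.Irrevocable o) :
    (B.switch c z₀).Irrevocable (Sum.elim (fun _ => none) o) := by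
  rintro (y | z) i v hv z' hz'
  · simp at hv
  · obtain ⟨z', hz, rfl⟩ := (PMF.mem_support_map_iff _ _ _).1 hz'
    exact h z i v hv z' hz

theorem redirect_mem_support {s : S} (hz₀ : ((s, c), z₀) ∈ (law A.record B c.length).support)
    {g : (S × List (O × I)) × Z} (hg : g ∈ (law A.record B c.length).support) :
    (g.1.1, redirect c z₀ g) ∈ (law A B c.length).support := by
  rw [← law_record_map, PMF.mem_support_map_iff]
  refine ⟨(g.1, redirect c z₀ g), ?_, rfl⟩
  unfold redirect
  split
  · next h =>
    obtain ⟨⟨s', c'⟩, z⟩ := g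
    subst h
    exact (indepGiven_record A B _).mem_support hg hz₀
  · exact hg

theorem exists_lt_prob_switch {G E : S × Z → Prop} {θ : ℝ≥0∞} {s : S}
    (hz₀ : ((s, c), z₀) ∈ (law A.record B c.length).support)
    (hE : Persistent (round A B) E)
    (hGE : ∀ t, ∀ x ∈ (law A B t).support, G x →
      ⨆ t', prob (chain (round A B) (PMF.pure x) t') E = 1)
    (hθ : θ < prob (law A.record B c.length) fun g => G (g.1.1, redirect c z₀ g)) :
    ∃ t, θ < prob (law A (B.switch c z₀) t) fun g => ∃ z, g.2 = .inr z ∧ E (g.1, z) := by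
  set μ := (law A.record B c.length).map fun g => (g.1.1, redirect c z₀ g)
  have hle : prob μ G ≤ ⨆ t, prob (chain (round A B) μ t) E := by
    rw [hE.iSup_prob_chain]
    refine expect_mono fun x hx => ?_
    obtain ⟨g, hg, rfl⟩ := (PMF.mem_support_map_iff _ _ _).1 hx
    by_cases hG : G (g.1.1, redirect c z₀ g)
    · rw [hGE _ _ (redirect_mem_support hz₀ hg) hG]
      exact iverson_le_one _
    · simp [iverson_false hG]
  rw [← prob_map (law A.record B c.length)] at hθ
  obtain ⟨t, ht⟩ := lt_iSup_iff.1 (hθ.trans_le hle)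
  refine ⟨c.length + t, ?_⟩
  rw [law_switch_add, prob_map]
  simpa using ht

end Switch

end Party

namespace Party

/-! ### Parties around a hub -/

section Star

variable {ι : Type*} [Fintype ι] {S S' : ι → Type*} {Q I O : Type*}

/-- Parties that act side by side, independently of each other. -/
def pi (A : ∀ i, Party (S i) I O) : Party (∀ i, S i) (ι → I) (ι → O) where
  init := indep fun i => (A i).init
  out s i := (A i).out (s i)
  step s m := indep fun i => (A i).step (s i) (m i)

/-- Morphisms act side by side. -/
def piHom {A : ∀ i, Party (S i) I O} {A' : ∀ i, Party (S' i) I O} (f : ∀ i, Hom (A i) (A' i)) :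
    Hom (pi A) (pi A') where
  map s i := (f i).map (s i)
  init := by simp only [pi, indep_map, (f _).init]
  out s := funext fun i => (f i).out (s i)
  step s m := by simp only [pi, indep_map, (f _).step]

/-- Forgetting all records. -/
def eraseRecords (x : (∀ j, S j × List (O × I)) × Q) : (∀ j, S j) × Q :=
  (fun j => (x.1 j).1, x.2)

theorem round_eraseRecords (A : ∀ i, Party (S i) I O) (R : Party Q (ι → O) (ι → I))
    (x : (∀ j, S j × List (O × I)) × Q) :
    (round (pi fun j => (A j).record) R x).map eraseRecords = round (pi A) R (eraseRecords x) :=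
  round_map (piHom fun j => recordHom (A j)) (Hom.id R) x

variable [DecidableEq ι]

/-- What the `i`-th of several parties around the hub `R` talks to: the hub together with the
other parties. -/
def rest (i : ι) {T : {j // j ≠ i} → Type*} (A : ∀ j, Party (T j) I O)
    (R : Party Q (ι → O) (ι → I)) : Party (Q × ∀ j, T j) O I where
  init := pmfProd R.init (indep fun j => (A j).init)
  out z := R.out z.1 i
  step z o := pmfProd
    (R.step z.1 ((Equiv.piSplitAt i fun _ => O).symm (o, fun j => (A j).out (z.2 j))))
    (indep fun j => (A j).step (z.2 j) (R.out z.1 j))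

theorem Irrevocable.rest {V : Type*} {R : Party Q (ι → O) (ι → I)} {o : Q → Option V}
    (h : R.Irrevocable o) (i : ι) {T : {j // j ≠ i} → Type*} (A : ∀ j, Party (T j) I O) :
    (rest i A R).Irrevocable fun z => o z.1 :=
  fun _ _ v hv _ hz' => h _ _ v hv _ (mem_support_pmfProd.1 hz').1

/-- Morphisms of the other parties act on the rest. -/
def restHom (i : ι) {T T' : {j // j ≠ i} → Type*} {A : ∀ j, Party (T j) I O}
    {A' : ∀ j, Party (T' j) I O} (f : ∀ j, Hom (A j) (A' j))
    (R : Party Q (ι → O) (ι → I)) : Hom (rest i A R) (rest i A' R) where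
  map := Prod.map id fun s j => (f j).map (s j)
  init := by simp only [rest, pmfProd_map, PMF.map_id, indep_map, (f _).init]
  out _ := rfl
  step z o := by
    simp only [rest, pmfProd_map, PMF.map_id, indep_map, (f _).step, Prod.map_fst, Prod.map_snd,
      (f _).out, id]

/-- Singling out one of the parties around a hub. -/
def isolate (i : ι) : (∀ j, S j) × Q ≃ S i × (Q × ∀ j : {j // j ≠ i}, S j) :=
  ((Equiv.piSplitAt i S).prodCongr (Equiv.refl Q)).trans <|
    (Equiv.prodAssoc _ _ _).trans <| (Equiv.refl _).prodCongr (Equiv.prodComm _ _)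

theorem pmfProd_indep_map_isolate (P : ∀ j, PMF (S j)) (ν : PMF Q) (i : ι) :
    (pmfProd (indep P) ν).map (isolate i) =
      pmfProd (P i) (pmfProd ν (indep fun j : {j // j ≠ i} => P j)) := by
  ext y
  have h : indep P ((Equiv.piSplitAt i S).symm (y.1, y.2.2)) =
      P i y.1 * indep (fun j : {j // j ≠ i} => P j) y.2.2 := by
    rw [← map_equiv_apply, indep_map_piSplitAt, pmfProd_apply]
  rw [map_equiv_apply, pmfProd_apply, pmfProd_apply, pmfProd_apply]
  change indep P ((Equiv.piSplitAt i S).symm (y.1, y.2.2)) * ν y.2.1 = _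
  rw [h]
  ring

variable (A : ∀ i, Party (S i) I O) (R : Party Q (ι → O) (ι → I))

theorem round_isolate (i : ι) (x : (∀ j, S j) × Q) :
    (round (pi A) R x).map (isolate i) = round (A i) (rest i (fun j => A j) R) (isolate i x) := by
  have hmsg : (Equiv.piSplitAt i fun _ => O).symm ((A i).out (x.1 i),
      fun j : {j // j ≠ i} => (A j).out (x.1 j)) = (pi A).out x.1 :=
    (Equiv.piSplitAt i fun _ => O).symm_apply_apply fun j => (A j).out (x.1 j)
  rw [round, ← hmsg]
  exact pmfProd_indep_map_isolate _ _ i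

theorem law_isolate (i : ι) (t : ℕ) :
    (law (pi A) R t).map (isolate i) = law (A i) (rest i (fun j => A j) R) t := by
  rw [law, chain_map (round_isolate A R i), pi, pmfProd_indep_map_isolate]
  rfl

/-- The configuration of the parties and the hub, from the state of the `i`-th party and the
state of the rest when the other parties keep records. -/
def assemble (i : ι) (x : S i × (Q × ∀ j : {j // j ≠ i}, S j × List (O × I))) : (∀ j, S j) × Q :=
  (isolate i).symm (x.1, x.2.1, fun j => (x.2.2 j).1)

omit [Fintype ι] in
theorem assemble_fst_self (i : ι) (x : S i × (Q × ∀ j : {j // j ≠ i}, S j × List (O × I))) :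
    (assemble i x).1 i = x.1 :=
  congrArg Prod.fst ((Equiv.piSplitAt i S).apply_symm_apply (x.1, fun j => (x.2.2 j).1))

omit [Fintype ι] in
theorem assemble_isolate (i : ι) (x : (∀ j, S j × List (O × I)) × Q) :
    assemble i ((isolate i x).1.1, (isolate i x).2) = eraseRecords x :=
  (isolate i).symm_apply_apply (eraseRecords x)

theorem round_assemble (i : ι) (x : S i × (Q × ∀ j : {j // j ≠ i}, S j × List (O × I))) :
    (round (A i) (rest i (fun j => (A j).record) R) x).map (assemble i) =
      round (pi A) R (assemble i x) := by
  set f := restHom i (fun j : {j // j ≠ i} => recordHom (A j)) R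
  set y := Prod.map (Hom.id (A i)).map f.map x
  calc (round (A i) (rest i (fun j => (A j).record) R) x).map (assemble i)
      = ((round (A i) (rest i (fun j => (A j).record) R) x).map
          (Prod.map (Hom.id (A i)).map f.map)).map (isolate i).symm := (PMF.map_comp _ _ _).symm
    _ = (round (A i) (rest i (fun j => A j) R) (isolate i ((isolate i).symm y))).map
          (isolate i).symm := by rw [round_map, Equiv.apply_symm_apply]
    _ = round (pi A) R (assemble i x) := by
      rw [← round_isolate, PMF.map_comp, Equiv.symm_comp_self, PMF.map_id]
      rfl

theorem law_assemble (i : ι) (t : ℕ) :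
    (law (A i) (rest i (fun j => (A j).record) R) t).map (assemble i) = law (pi A) R t := by
  set f := restHom i (fun j : {j // j ≠ i} => recordHom (A j)) R
  calc (law (A i) (rest i (fun j => (A j).record) R) t).map (assemble i)
      = ((law (A i) (rest i (fun j => (A j).record) R) t).map
          (Prod.map (Hom.id (A i)).map f.map)).map (isolate i).symm := (PMF.map_comp _ _ _).symm
    _ = law (pi A) R t := by
      rw [law_map, ← law_isolate, PMF.map_comp, Equiv.symm_comp_self, PMF.map_id]

theorem uninformative_rest_iff (good : (∀ i, S i) × Q → Prop) (i : ι) (t : ℕ) {W : Type*}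
    (f : (S i × List (O × I)) × (Q × ∀ j : {j // j ≠ i}, S j × List (O × I)) → W) :
    Uninformative (law (A i).record (rest i (fun j => (A j).record) R) t) f
        (fun g => good (assemble i (g.1.1, g.2))) ↔
      Uninformative (law (pi fun j => (A j).record) R t) (fun x => f (isolate i x))
        fun x => good (eraseRecords x) := by
  rw [← law_isolate (fun j => (A j).record), uninformative_map]
  simp only [assemble_isolate]

end Star

end Party

namespace Party

/-! ### Some switch is profitable -/

section Decides

variable {ι : Type*} [Fintype ι] {S : ι → Type*} {Q I O : Type*}
  {A : ∀ i, Party (S i) I O} {R : Party Q (ι → O) (ι → I)}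
  {good correct : (∀ i, S i) × Q → Prop} {accept : Q → Prop}

/-- The hub `R` together with the parties `A` almost surely finds out whether the event `good`,
which is fixed from the start, occurs: from some time on, the configuration is `correct`, and
then the hub accepts if and only if `good` occurs. -/
structure Decides (A : ∀ i, Party (S i) I O) (R : Party Q (ι → O) (ι → I))
    (good correct : (∀ i, S i) × Q → Prop) (accept : Q → Prop) : Prop where
  good_iff : ∀ x, ∀ y ∈ (round (pi A) R x).support, good y ↔ good x
  persistent_correct : Persistent (round (pi A) R) correct
  persistent_accept : Persistent (round (pi A) R) fun x => accept x.2
  accept_iff : ∀ x, correct x → (accept x.2 ↔ good x)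
  eventually_correct : ⨆ t, prob (law (pi A) R t) correct = 1

namespace Decides

variable (h : Decides A R good correct accept)
include h

theorem persistent_good : Persistent (round (pi A) R) good :=
  fun x hx y hy => (h.good_iff x y hy).2 hx

theorem prob_law_good (t : ℕ) : prob (law (pi A) R t) good = prob (law (pi A) R 0) good := by
  induction t with
  | zero => rfl
  | succ t ih =>
    rw [← ih, law, chain, prob_bind]
    refine expect_congr fun x _ => ?_
    rw [← expect_const (round (pi A) R x) (iverson (good x))]
    exact expect_congr fun y hy => by rw [propext (h.good_iff x y hy)]

theorem iSup_prob_chain_pure_eq_one {t : ℕ} {x : (∀ i, S i) × Q}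
    (hx : x ∈ (law (pi A) R t).support) (hgood : good x) :
    ⨆ t', prob (chain (round (pi A) R) (PMF.pure x) t') (fun y => correct y ∧ good y) = 1 := by
  rw [← h.persistent_correct.iSup_prob_chain_pure_eq_one h.eventually_correct hx]
  exact iSup_congr fun t' => prob_congr fun y hy =>
    and_iff_left (h.persistent_good.of_mem_support_chain hgood hy)

theorem not_uninformative (h0 : prob (law (pi A) R 0) good ≠ 0)
    (h1 : prob (law (pi A) R 0) good < 1)
    (hhub : ∀ t, Uninformative (law (pi A) R t) (fun x => x.2) good) : False := by
  set θ := prob (law (pi A) R 0) good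
  set x := ⨆ t, prob (law (pi A) R t) fun x => accept x.2
  have hindep : ⨆ t, prob (law (pi A) R t) (fun x => accept x.2 ∧ good x) = θ * x := by
    rw [ENNReal.mul_iSup]
    exact iSup_congr fun t => by rw [(hhub t).prob_and, h.prob_law_good]
  have hcorrect := h.persistent_correct.prob_chain_mono (pmfProd (pi A).init R.init)
  have hgood : θ ≤ θ * x :=
    calc θ ≤ ⨆ t, prob (law (pi A) R t) good := le_iSup (fun t => prob (law (pi A) R t) good) 0
      _ ≤ ⨆ t, prob (law (pi A) R t) fun x => accept x.2 ∧ good x :=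
        iSup_prob_le_iSup_prob hcorrect (h.persistent_good.prob_chain_mono _)
          h.eventually_correct fun _ x _ hx hg => ⟨(h.accept_iff x hx).2 hg, hg⟩
      _ = θ * x := hindep
  have haccept : x ≤ θ * x := by
    rw [← hindep]
    exact iSup_prob_le_iSup_prob hcorrect (h.persistent_accept.prob_chain_mono _)
      h.eventually_correct fun _ x _ hx ha => ⟨ha, (h.accept_iff x hx).1 ha⟩
  have hx1 : x ≤ 1 := iSup_le fun t => prob_le_one _ _
  have hxθ : x ≤ θ := haccept.trans (mul_le_of_le_one_right' hx1)
  have hlt : θ * x < θ * 1 :=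
    ENNReal.mul_lt_mul_right h0 (h1.trans ENNReal.one_lt_top).ne (hxθ.trans_lt h1)
  rw [mul_one] at hlt
  exact hlt.not_ge hgood

theorem good_eraseRecords_iff {x y : (∀ j, S j × List (O × I)) × Q}
    (hy : y ∈ (round (pi fun j => (A j).record) R x).support) :
    good (eraseRecords y) ↔ good (eraseRecords x) :=
  h.good_iff _ _ <| by
    rw [← round_eraseRecords]
    exact (PMF.mem_support_map_iff _ _ _).2 ⟨y, hy, rfl⟩

variable [DecidableEq ι]

theorem exists_lt_prob_switch {i : ι} {c : List (O × I)}
    {z : Q × ∀ j : {j // j ≠ i}, S j × List (O × I)} {s : S i}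
    (hz : ((s, c), z) ∈ (law (A i).record (rest i (fun j => (A j).record) R) c.length).support)
    {θ : ℝ≥0∞}
    (hθ : θ < prob (law (A i).record (rest i (fun j => (A j).record) R) c.length) fun g =>
      good (assemble i (g.1.1, redirect c z g))) :
    ∃ t, θ < prob (law (A i) ((rest i (fun j => (A j).record) R).switch c z) t) fun g =>
      ∃ z', g.2 = .inr z' ∧ correct (assemble i (g.1, z')) ∧ good (assemble i (g.1, z')) := by
  have hE : Persistent (round (pi A) R) fun x => correct x ∧ good x :=
    fun x hx y hy => ⟨h.persistent_correct x hx.1 y hy, h.persistent_good x hx.2 y hy⟩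
  refine Party.exists_lt_prob_switch (G := fun x => good (assemble i x))
    (E := fun x => correct (assemble i x) ∧ good (assemble i x)) hz
    (hE.comap (round_assemble A R i)) (fun t x hx hgood => ?_) hθ
  have hx' : assemble i x ∈ (law (pi A) R t).support := by
    rw [← law_assemble A R i]
    exact (PMF.mem_support_map_iff _ _ _).2 ⟨x, hx, rfl⟩
  rw [← h.iSup_prob_chain_pure_eq_one hx' hgood]
  exact iSup_congr fun t' => by rw [← PMF.pure_map, ← chain_map (round_assemble A R i), prob_map]

theorem uninformative_rest {i : ι}
    (hno : ∀ c z t, prob (law (A i) ((rest i (fun j => (A j).record) R).switch c z) t) (fun g =>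
      ∃ z', g.2 = .inr z' ∧ correct (assemble i (g.1, z')) ∧ good (assemble i (g.1, z'))) ≤
        prob (law (pi A) R 0) good) {t : ℕ}
    (htr : Uninformative (law (A i).record (rest i (fun j => (A j).record) R) t)
      (fun g => g.1.2) fun g => good (assemble i (g.1.1, g.2))) :
    Uninformative (law (A i).record (rest i (fun j => (A j).record) R) t)
      (fun g => g.2) fun g => good (assemble i (g.1.1, g.2)) := by
  refine (indepGiven_record _ _ t).uninformative_of_prob_redirect_le
    (E := fun s z => good (assemble i (s, z))) htr fun c z s hz => ?_
  obtain rfl : c.length = t := length_record hz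
  have hgood : prob (law (A i).record (rest i (fun j => (A j).record) R) c.length)
      (fun g => good (assemble i (g.1.1, g.2))) = prob (law (pi A) R 0) good := by
    rw [← h.prob_law_good c.length, ← law_assemble A R i, prob_map, ← law_record_map (A i),
      prob_map]
  rw [hgood]
  by_contra! hlt
  obtain ⟨t, ht⟩ := h.exists_lt_prob_switch hz hlt
  exact ht.not_ge (hno c z t)

/-- As long as the transcripts carry no information, so does the rest of the configuration, and
the rest determines the next entry of the transcript of any other party. -/
theorem uninformative_transcript [Nontrivial ι]
    (hno : ∀ i c z t, prob (law (A i) ((rest i (fun j => (A j).record) R).switch c z) t) (fun g =>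
      ∃ z', g.2 = .inr z' ∧ correct (assemble i (g.1, z')) ∧ good (assemble i (g.1, z'))) ≤
        prob (law (pi A) R 0) good) (t : ℕ) (i : ι) :
    Uninformative (law (A i).record (rest i (fun j => (A j).record) R) t)
      (fun g => g.1.2) fun g => good (assemble i (g.1.1, g.2)) := by
  induction t generalizing i with
  | zero =>
    refine uninformative_of_forall_eq (b := []) (fun g hg => ?_) _
    exact List.eq_nil_of_length_eq_zero (length_record hg)
  | succ t ih =>
    obtain ⟨j, hj⟩ := exists_ne i
    have hrest := (uninformative_rest_iff A R good j t _).1 (h.uninformative_rest (hno j) (ih j))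
    rw [uninformative_rest_iff]
    refine (hrest.comp fun z => ((A i).out (z.2 ⟨i, hj.symm⟩).1, R.out z.1 i) ::
      (z.2 ⟨i, hj.symm⟩).2).bind (fun x y hy => ?_) fun x y hy => h.good_eraseRecords_iff hy
    have hi := mem_support_of_mem_support_indep (mem_support_pmfProd.1 hy).1 i
    obtain ⟨s, -, hs⟩ := (PMF.mem_support_map_iff _ _ _).1 hi
    exact (congrArg Prod.snd hs).symm

theorem exists_profitable_switch [Nontrivial ι] (h0 : prob (law (pi A) R 0) good ≠ 0)
    (h1 : prob (law (pi A) R 0) good < 1) :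
    ∃ i c z t, prob (law (pi A) R 0) good <
      prob (law (A i) ((rest i (fun j => (A j).record) R).switch c z) t) fun g =>
        ∃ z', g.2 = .inr z' ∧ correct (assemble i (g.1, z')) ∧ good (assemble i (g.1, z')) := by
  by_contra! hno
  obtain ⟨i⟩ := (inferInstance : Nonempty ι)
  refine h.not_uninformative h0 h1 fun t => ?_
  have hrest := h.uninformative_rest (hno i) (h.uninformative_transcript hno t i)
  rw [← law_assemble A R i, uninformative_map, ← law_record_map (A i), uninformative_map]
  exact hrest.comp fun z => z.1

end Decides

end Decides

end Party

namespace Party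

/-! ### Random parties -/

section Mix

variable {H I O Z : Type*} {T : H → Type*}

/-- The party that first draws which of the parties `P h` it is. -/
def mix (π : PMF H) (P : ∀ h, Party (T h) I O) : Party (Σ h, T h) I O where
  init := pmfSigma π fun h => (P h).init
  out s := (P s.1).out s.2
  step s i := ((P s.1).step s.2 i).map (Sigma.mk s.1)

theorem law_mix (π : PMF H) (P : ∀ h, Party (T h) I O) (B : Party Z O I) (t : ℕ) :
    law (mix π P) B t = π.bind fun h => (law (P h) B t).map fun g => (⟨h, g.1⟩, g.2) := by
  induction t with
  | zero =>
    simp only [law, chain, mix, pmfProd, pmfSigma, PMF.bind_bind, PMF.bind_map, PMF.map_bind,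
      PMF.map_comp, Function.comp_def]
  | succ t ih =>
    rw [law, chain, ← law, ih]
    simp only [law, chain, PMF.bind_bind, PMF.bind_map, PMF.map_bind]
    simp only [round, mix, pmfProd, PMF.map_bind, PMF.bind_map, PMF.map_comp, Function.comp_def]

theorem prob_law_mix (π : PMF H) (P : ∀ h, Party (T h) I O) (B : Party Z O I) (t : ℕ)
    (E : (Σ h, T h) × Z → Prop) :
    prob (law (mix π P) B t) E =
      expect π fun h => prob (law (P h) B t) fun g => E (⟨h, g.1⟩, g.2) := by
  simp only [law_mix, prob_bind, prob_map]

variable {ι : Type*} [Fintype ι] {Q : Type*} {H : ι → Type*} {T : ∀ i, H i → Type*}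

/-- Random parties side by side can be drawn in advance. -/
def mixPiHom (π : ∀ i, PMF (H i)) (P : ∀ i h, Party (T i h) I O) :
    Hom (mix (indep π) fun a => pi fun i => P i (a i)) (pi fun i => mix (π i) (P i)) where
  map s i := ⟨s.1 i, s.2 i⟩
  init := by simp only [mix, pi, indep_pmfSigma]
  out _ := rfl
  step s m := by
    simp only [mix, pi, PMF.map_comp, Function.comp_def]
    exact indep_map _ fun i => Sigma.mk (s.1 i)

theorem prob_law_pi_mix (π : ∀ i, PMF (H i)) (P : ∀ i h, Party (T i h) I O)
    (R : Party Q (ι → O) (ι → I)) (t : ℕ) (E : (∀ i, Σ h, T i h) × Q → Prop) :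
    prob (law (pi fun i => mix (π i) (P i)) R t) E =
      expect (indep π) fun a => prob (law (pi fun i => P i (a i)) R t) fun g =>
        E (fun i => ⟨a i, g.1 i⟩, g.2) := by
  rw [← law_map (mixPiHom π P) (Hom.id R), prob_map, prob_law_mix]
  rfl

variable {π : ∀ i, PMF (H i)} {P : ∀ i h, Party (T i h) I O} {R : Party Q (ι → O) (ι → I)}

theorem round_pi_mix (x : (∀ i, Σ h, T i h) × Q) :
    (round (pi fun i => P i (x.1 i).1) R (fun i => (x.1 i).2, x.2)).map
        (Prod.map (fun s i => ⟨(x.1 i).1, s i⟩) id) =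
      round (pi fun i => mix (π i) (P i)) R x := by
  simp only [round, pmfProd_map, PMF.map_id, pi, mix, indep_map _ fun i => Sigma.mk (x.1 i).1]

theorem mem_support_round_pi_mix {x y : (∀ i, Σ h, T i h) × Q}
    (hy : y ∈ (round (pi fun i => mix (π i) (P i)) R x).support) :
    ∃ g ∈ (round (pi fun i => P i (x.1 i).1) R (fun i => (x.1 i).2, x.2)).support,
      y = (fun i => ⟨(x.1 i).1, g.1 i⟩, g.2) := by
  rw [← round_pi_mix, PMF.mem_support_map_iff] at hy
  obtain ⟨g, hg, rfl⟩ := hy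
  exact ⟨g, hg, rfl⟩

variable {good : (∀ i, H i) → Prop} {correct : ∀ a : ∀ i, H i, (∀ i, T i (a i)) × Q → Prop}
  {accept : Q → Prop}

theorem prob_law_pi_mix_fst (t : ℕ) :
    prob (law (pi fun i => mix (π i) (P i)) R t) (fun x => good fun i => (x.1 i).1) =
      prob (indep π) good := by
  rw [prob_law_pi_mix]
  exact congrArg _ <| funext fun a => expect_const _ (iverson (good a))

theorem decides_mix
    (h : ∀ a, Decides (fun i => P i (a i)) R (fun _ => good a) (correct a) accept) :
    Decides (fun i => mix (π i) (P i)) R (fun x => good fun i => (x.1 i).1)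
      (fun x => correct (fun i => (x.1 i).1) (fun i => (x.1 i).2, x.2)) accept where
  good_iff x y hy := by
    obtain ⟨g, -, rfl⟩ := mem_support_round_pi_mix hy
    rfl
  persistent_correct x hx y hy := by
    obtain ⟨g, hg, rfl⟩ := mem_support_round_pi_mix hy
    exact (h _).persistent_correct _ hx g hg
  persistent_accept x hx y hy := by
    obtain ⟨g, hg, rfl⟩ := mem_support_round_pi_mix hy
    exact (h _).persistent_accept _ hx g hg
  accept_iff x hx := (h _).accept_iff _ hx
  eventually_correct := by
    simp only [prob_law_pi_mix]
    refine (expect_iSup fun a => (h a).persistent_correct.prob_chain_mono _).symm.trans ?_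
    exact (congrArg _ <| funext fun a => (h a).eventually_correct).trans (expect_const _ _)

end Mix

end Party

open Party

/-! ### A network seen from one agent -/

section OneAgent

variable {X M Y : Type}

theorem configLaw_eq_chain (N : Network) (prof : Fin N.n → Strategy X M Y) (x : Fin N.n → X)
    (t : ℕ) :
    configLaw N prof x t =
      chain (fun c => indep fun v => (prof v).step (c v) (N.deg v) (received N c v))
        (indep fun v => (prof v).init (N.ident v) (N.deg v) (x v)) t := by
  induction t with
  | zero => rfl
  | succ t ih => rw [configLaw, ih]; rfl

theorem utility_eq_iverson {n : ℕ} (a : Fin n) (p : Y) (O : Fin n → Option Y) :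
    utility a p O = iverson (∀ b, O b = some p) := by
  have hiff : (O a = some p ∧ Legal O) ↔ ∀ b, O b = some p :=
    ⟨fun ⟨ha, hlegal⟩ b => (hlegal b a).1.trans ha,
      fun h => ⟨h a, fun b c => ⟨by rw [h, h], by simp [h]⟩⟩⟩
  by_cases h : O a = some p ∧ Legal O
  · rw [utility, if_pos h, iverson_true (hiff.1 h)]
  · rw [utility, if_neg h, iverson_false (mt hiff.2 h)]

/-- A single agent as a party. -/
def Strategy.toParty (S : Strategy X M Y) (ident d : ℕ) (x : X) :
    Party S.State (Fin d → M) (Fin d → M) where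
  init := S.init ident d x
  out s k := S.msg s k
  step s m := S.step s d m

theorem Strategy.step_congr (S : Strategy X M Y) {n n' : ℕ} (h : n = n') (s : S.State)
    (r : Fin n → M) : S.step s n r = S.step s n' fun k => r (Fin.cast h.symm k) := by
  subst h
  rfl

/-- A network with a distinguished agent of degree `d`. -/
structure Rooted (d : ℕ) where
  net : Network
  root : Fin net.n
  deg_root : net.deg root = d

namespace Rooted

variable {d : ℕ} (N : Rooted d)

/-- The agents other than the distinguished one. -/
abbrev Other : Type := {v : Fin N.net.n // v ≠ N.root}

/-- The ports of the distinguished agent. -/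
def port : Fin d ≃ N.net.G.neighborSet N.root :=
  (finCongr N.deg_root.symm).trans (N.net.port N.root)

/-- The agent behind a port of the distinguished agent. -/
def neighbor (k : Fin d) : N.Other := ⟨N.port k, ((N.port k).2 : N.net.G.Adj _ _).ne'⟩

theorem adj_neighbor (k : Fin d) : N.net.G.Adj (N.neighbor k) N.root :=
  SimpleGraph.Adj.symm (N.port k).2

theorem neighbor_injective : Function.Injective N.neighbor := fun _ _ h =>
  N.port.injective <| Subtype.ext <| congrArg (fun v : N.Other => (v : Fin N.net.n)) h

/-- The port through which the distinguished agent sees its neighbour `v`. -/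
def portTo {v : N.Other} (h : N.net.G.Adj v N.root) : Fin d := N.port.symm ⟨v, h.symm⟩

theorem portTo_neighbor (k : Fin d) : N.portTo (N.adj_neighbor k) = k :=
  N.port.symm_apply_apply k

theorem neighbor_portTo {v : N.Other} (h : N.net.G.Adj v N.root) : N.neighbor (N.portTo h) = v :=
  Subtype.ext <| congrArg (fun u : N.net.G.neighborSet N.root => (u : Fin N.net.n))
    (N.port.apply_symm_apply ⟨v, h.symm⟩)

theorem adj_root {v : N.Other} {u : N.net.G.neighborSet v} (h : (u : Fin N.net.n) = N.root) :
    N.net.G.Adj v N.root := by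
  have hu := u.2
  rwa [h] at hu

variable (P : N.Other → Strategy X M Y)

/-- The messages that reach an agent if the distinguished agent sends `m`. -/
def incoming (s : ∀ v, (P v).State) (m : Fin d → M) (v : N.Other) (k : Fin (N.net.deg v)) : M :=
  if h : (N.net.port v k : Fin N.net.n) = N.root then m (N.portTo (N.adj_root h))
  else (P ⟨N.net.port v k, h⟩).msg (s ⟨N.net.port v k, h⟩)
    ((N.net.port (N.net.port v k)).symm ⟨v, SimpleGraph.Adj.symm (N.net.port v k).2⟩ : Fin _)

/-- All agents other than the distinguished one, executing the strategies `P`, as one party. -/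
def others (x : N.Other → X) : Party (∀ v, (P v).State) (Fin d → M) (Fin d → M) where
  init := indep fun v => (P v).init (N.net.ident v) (N.net.deg v) (x v)
  out s k := (P (N.neighbor k)).msg (s (N.neighbor k))
    ((N.net.port (N.neighbor k)).symm ⟨N.root, N.adj_neighbor k⟩ : Fin _)
  step s m := indep fun v => (P v).step (s v) (N.net.deg v) (N.incoming P s m v)

/-- The probability that the distinguished agent, running `S` with input `i`, and the other
agents, running `P` with inputs `x`, eventually all output `p`. -/
def consensusProb (S : Strategy X M Y) (x : N.Other → X) (i : X) (p : Y) : ℝ≥0∞ :=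
  ⨆ t, prob (law (N.others P x) (S.toParty (N.net.ident N.root) d i) t) fun g =>
    (∀ v, (P v).out (g.1 v) = some (some p)) ∧ S.out g.2 = some (some p)

section Split

variable {prof : Fin N.net.n → Strategy X M Y}

/-- The states of the other agents and that of the distinguished one. -/
def split (c : Config N.net prof) : (∀ v : N.Other, (prof v).State) × (prof N.root).State :=
  (fun v => c v, c N.root)

theorem indep_map_split (ν : ∀ v, PMF (prof v).State) :
    (indep ν).map N.split = pmfProd (indep fun v : N.Other => ν v) (ν N.root) := by
  rw [← pmfProd_map_swap, ← indep_map_piSplitAt, PMF.map_comp]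
  rfl

theorem received_other (c : Config N.net prof) (v : N.Other) :
    received N.net c v = N.incoming (fun v => prof v) (fun v => c v)
      (fun k : Fin d => (prof N.root).msg (c N.root) k) v := by
  funext k
  have hroot : ∀ w (hw : N.net.G.Adj v w) (h : N.net.G.Adj v N.root), w = N.root →
      (prof w).msg (c w) ((N.net.port w).symm ⟨v, hw.symm⟩ : Fin _) =
        (prof N.root).msg (c N.root) (N.portTo h : ℕ) := by
    rintro w hw h rfl
    rfl
  by_cases h : (N.net.port v k : Fin N.net.n) = N.root
  · simp only [incoming, dif_pos h]
    exact hroot _ (N.net.port v k).2 (N.adj_root h) h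
  · simp only [incoming, dif_neg h]
    rfl

theorem configLaw_map_split (x : Fin N.net.n → X) (t : ℕ) :
    (configLaw N.net prof x t).map N.split =
      law (N.others (fun v => prof v) fun v => x v)
        ((prof N.root).toParty (N.net.ident N.root) d (x N.root)) t := by
  have hinit : (indep fun v => (prof v).init (N.net.ident v) (N.net.deg v) (x v)).map N.split =
      pmfProd (N.others (fun v => prof v) fun v => x v).init
        ((prof N.root).toParty (N.net.ident N.root) d (x N.root)).init := by
    rw [indep_map_split]
    simp only [others, Strategy.toParty, N.deg_root]
  rw [configLaw_eq_chain, law, ← hinit]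
  refine chain_map (fun c => ?_) _ t
  rw [indep_map_split, Party.round, (prof N.root).step_congr N.deg_root]
  simp only [received_other]
  rfl

theorem utility_outputs (c : Config N.net prof) (p : Y) :
    utility N.root p (outputs N.net c) =
      iverson ((∀ v : N.Other, (prof v).out (c v) = some (some p)) ∧
        (prof N.root).out (c N.root) = some (some p)) := by
  rw [utility_eq_iverson]
  congr 1
  simp only [outputs, Option.join_eq_some_iff, eq_iff_iff]
  refine ⟨fun h => ⟨fun v => h v, h N.root⟩, fun ⟨hother, hroot⟩ v => ?_⟩
  by_cases hv : v = N.root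
  · rw [hv, hroot]
  · exact hother ⟨v, hv⟩

theorem runUtility_eq_consensusProb (p : Y) (x : Fin N.net.n → X) :
    runUtility N.net prof N.root p x =
      N.consensusProb (fun v => prof v) (prof N.root) (fun v => x v) (x N.root) p := by
  unfold runUtility consensusProb
  refine iSup_congr fun t => ?_
  rw [← configLaw_map_split, prob_map]
  exact tsum_congr fun c => by rw [N.utility_outputs]; rfl

end Split

theorem networkUtility_eq [Fintype X] [Nonempty X] (Λ S : Strategy X M Y) (p : Y) (i : X) :
    networkUtility Λ S p i ⟨N.net, N.root⟩ =
      expect (PMF.uniformOfFintype (N.Other → X)) fun x =>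
        N.consensusProb (fun _ => Λ) S x i p := by
  have hrun : ∀ x : Fin N.net.n → X, runUtility N.net (Function.update (fun _ => Λ) N.root S)
      N.root p (Function.update x N.root i) =
        N.consensusProb (fun _ => Λ) S (fun v => x v) i p := fun x => by
    have hother : ∀ v : N.Other, Function.update (fun _ => Λ) N.root S v = Λ :=
      fun v => Function.update_of_ne v.2 _ _
    have hinput : ∀ v : N.Other, Function.update x N.root i v = x v :=
      fun v => Function.update_of_ne v.2 _ _
    rw [runUtility_eq_consensusProb, funext hother, funext hinput, Function.update_self,
      Function.update_self]
  unfold networkUtility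
  simp only [hrun]
  rw [← expect, uniformOfFintype_pi_eq_indep, uniformOfFintype_pi_eq_indep]
  calc expect (indep fun _ => PMF.uniformOfFintype X)
        (fun x : Fin N.net.n → X => N.consensusProb (fun _ => Λ) S (fun v => x v) i p)
      = expect ((indep fun _ => PMF.uniformOfFintype X).map (Equiv.piSplitAt N.root fun _ => X))
          fun y => N.consensusProb (fun _ => Λ) S y.2 i p := by rw [expect_map]; rfl
    _ = _ := by simp only [indep_map_piSplitAt, expect_pmfProd, expect_const]

end Rooted

end OneAgent

/-! ### Networks on arbitrary finite vertex types -/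

/-- A graph with numbered edges, given by the edges at each vertex and their other ends. -/
structure LocalGraph (W : Type) where
  Nb : W → Type
  dir : ∀ w, Nb w → W
  dir_injective : ∀ w, Function.Injective (dir w)
  dir_ne : ∀ w k, dir w k ≠ w
  dir_symm : ∀ w k, ∃ k', dir (dir w k) k' = w
  deg : W → ℕ
  port : ∀ w, Fin (deg w) ≃ Nb w

namespace LocalGraph

variable {W : Type} (J : LocalGraph W)

/-- The underlying simple graph. -/
def graph : SimpleGraph W where
  Adj w w' := ∃ k, J.dir w k = w'
  symm := ⟨by
    rintro w _ ⟨k, rfl⟩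
    exact J.dir_symm w k⟩
  loopless := ⟨fun w ⟨k, hk⟩ => J.dir_ne w k hk⟩

/-- The edges at a vertex correspond to its neighbours. -/
def nbEquiv (w : W) : J.Nb w ≃ J.graph.neighborSet w :=
  Equiv.ofBijective (fun k => ⟨J.dir w k, k, rfl⟩)
    ⟨fun _ _ h => J.dir_injective w (congrArg Subtype.val h), by
      rintro ⟨_, k, rfl⟩
      exact ⟨k, rfl⟩⟩

variable {X M Y : Type} (Λ : Strategy X M Y)

/-- The messages that reach a vertex when all vertices run `Λ`. -/
def incoming (c : W → Λ.State) (w : W) (k : Fin (J.deg w)) : M :=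
  Λ.msg (c (J.dir w (J.port w k)))
    ((J.port _).symm (J.dir_symm w (J.port w k)).choose : Fin _)

theorem incoming_eq (c : W → Λ.State) {w w' : W} {k : Fin (J.deg w)} (h : J.dir w (J.port w k) = w')
    {k' : J.Nb w'} (hk' : J.dir w' k' = w) :
    J.incoming Λ c w k = Λ.msg (c w') ((J.port w').symm k' : Fin _) := by
  subst h
  have hchoose : (J.dir_symm w (J.port w k)).choose = k' :=
    J.dir_injective _ ((J.dir_symm w (J.port w k)).choose_spec.trans hk'.symm)
  rw [incoming, hchoose]

variable [Fintype W] (ident : W → ℕ)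

/-- The law of the states after `t` rounds when all vertices run `Λ`. -/
def vertexLaw (x : W → X) (t : ℕ) : PMF (W → Λ.State) :=
  chain (fun c => indep fun w => Λ.step (c w) (J.deg w) (J.incoming Λ c w))
    (indep fun w => Λ.init (ident w) (J.deg w) (x w)) t

variable {ident} (hident : Function.Injective ident)

/-- The network with vertices relabelled by `Fin n`. -/
abbrev net : Network where
  n := Fintype.card W
  G := J.graph.comap (Fintype.equivFin W).symm
  deg u := J.deg ((Fintype.equivFin W).symm u)
  port u := (J.port _).trans <| (J.nbEquiv _).trans <|
    (Fintype.equivFin W).subtypeEquiv fun w => by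
      simp [SimpleGraph.mem_neighborSet, SimpleGraph.comap_adj]
  ident u := ident ((Fintype.equivFin W).symm u)
  ident_injective := hident.comp (Fintype.equivFin W).symm.injective

theorem net_port_symm (u u' : Fin (J.net hident).n) (hu : (J.net hident).G.Adj u' u) {w' : W}
    (hw' : (Fintype.equivFin W).symm u' = w') {k' : J.Nb w'}
    (hk' : J.dir w' k' = (Fintype.equivFin W).symm u) :
    ((((J.net hident).port u').symm ⟨u, hu⟩ : Fin _) : ℕ) = ((J.port w').symm k' : Fin _) := by
  subst hw'
  congr 1
  rw [Equiv.symm_apply_eq]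
  refine Subtype.ext ?_
  simp only [Equiv.trans_apply, Equiv.apply_symm_apply]
  change u = Fintype.equivFin W (J.dir _ k')
  rw [hk', Equiv.apply_symm_apply]

theorem received_net (c : Fin (J.net hident).n → Λ.State) (u : Fin (J.net hident).n) :
    received (J.net hident) (prof := fun _ => Λ) c u =
      J.incoming Λ (fun w => c (Fintype.equivFin W w)) ((Fintype.equivFin W).symm u) := by
  funext k
  unfold received incoming
  simp only []
  congr 1
  exact J.net_port_symm hident u _ _ (Equiv.symm_apply_apply _ _)
    (J.dir_symm _ (J.port _ k)).choose_spec

theorem configLaw_net (x : W → X) (t : ℕ) :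
    (configLaw (J.net hident) (fun _ => Λ) (x ∘ (Fintype.equivFin W).symm) t).map
      (· ∘ Fintype.equivFin W) = J.vertexLaw Λ ident x t := by
  have hindep (P : W → PMF Λ.State) :
      (indep fun u => P ((Fintype.equivFin W).symm u)).map (· ∘ Fintype.equivFin W) = indep P := by
    refine (indep_map_arrowCongr _ (Fintype.equivFin W).symm).trans ?_
    simp
  rw [configLaw_eq_chain, vertexLaw, ← hindep]
  refine chain_map (fun c => ?_) _ t
  rw [← hindep]
  congr 2
  funext u
  rw [received_net, Function.comp_apply, Equiv.apply_symm_apply]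
  rfl

theorem twoConnected_net (h3 : 3 ≤ Fintype.card W)
    (h : ∀ s : Set W, sᶜ.Subsingleton → (J.graph.induce s).Connected) :
    TwoConnected (J.net hident).G := by
  refine ⟨h3, ?_, fun v => ?_⟩
  · have hJ := (SimpleGraph.induceUnivIso J.graph).connected_iff.1 (h Set.univ (by simp))
    exact (SimpleGraph.Iso.comap (Fintype.equivFin W).symm J.graph).connected_iff.2 hJ
  · let e : (J.net hident).G.induce {v}ᶜ ≃g J.graph.induce {(Fintype.equivFin W).symm v}ᶜ :=
      { toEquiv := (Fintype.equivFin W).symm.subtypeEquiv fun u =>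
          not_congr (Fintype.equivFin W).symm.injective.eq_iff.symm
        map_rel_iff' := Iff.rfl }
    exact e.connected_iff.2 (h _ (by simp))

end LocalGraph

/-! ### Joining networks through a complete graph -/

namespace Rooted

variable {d : ℕ} (N : Rooted d) {W : Type} (f : N.Other → W) (g : Fin d → W)

/-- The other ends of the edges at `v`, after removal of the distinguished agent: agents are
placed at the points `f` of `W`, and the port `k` of the distinguished agent is replaced by the
point `g k`. -/
def dir (v : N.Other) (u : N.net.G.neighborSet v) : W :=
  if h : (u : Fin N.net.n) = N.root then g (N.portTo (N.adj_root h)) else f ⟨u, h⟩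

variable {f g}

theorem dir_injective (hf : Function.Injective f) (hfg : ∀ v k, f v ≠ g k) (v : N.Other) :
    Function.Injective (N.dir f g v) := by
  rintro ⟨u, hu⟩ ⟨u', hu'⟩ h
  unfold dir at h
  refine Subtype.ext ?_
  simp only at h ⊢
  split_ifs at h with hroot hroot' hroot'
  · rw [hroot, hroot']
  · exact (hfg _ _ h.symm).elim
  · exact (hfg _ _ h).elim
  · exact congrArg Subtype.val (hf h)

end Rooted

section Middle

variable (ι : Type) {d L : ℕ}

/-- The vertices of the middle part. The vertex `inl k` is joined to the agents behind the `k`-th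
ports of the distinguished agents. -/
abbrev Mid (d L : ℕ) : Type := Fin d ⊕ Fin L

/-- The edges at a vertex of the middle part between networks indexed by `ι`. -/
abbrev MidNb (r : Mid d L) : Type :=
  {r' : Mid d L // r' ≠ r} ⊕ {p : ι × Fin d // Sum.inl p.2 = r}

/-- The degree of a vertex of the middle part. -/
def midDeg (r : Mid d L) : ℕ := Nat.card (MidNb ι r)

/-- The port numbering of the middle part. -/
def midPort [Finite ι] (r : Mid d L) : Fin (midDeg ι r) ≃ MidNb ι r :=
  (Finite.equivFin (MidNb ι r)).symm

/-- The identifiers of the middle part; those of the other parts are pairs whose first entry is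
not `0`. -/
def midIdent (r : Mid d L) : ℕ := Nat.pair 0 (finSumFinEquiv r)

variable {ι} [Finite ι] {X M Y : Type} (Λ : Strategy X M Y)

/-- The messages that reach a vertex of the middle part, if `m i` arrives from the `i`-th
network. -/
def midIncoming (s : Mid d L → Λ.State) (m : ι → Fin d → M) (r : Mid d L)
    (k : Fin (midDeg ι r)) : M :=
  match midPort ι r k with
  | Sum.inl r' => Λ.msg (s r') ((midPort ι r'.1).symm (Sum.inl ⟨r, r'.2.symm⟩) : Fin _)
  | Sum.inr p => m p.1.1 p.1.2

variable (ι d L) in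
/-- The middle part, executing the protocol `Λ` with all inputs equal to `x₀`. -/
def middle (x₀ : X) : Party (Mid d L → Λ.State) (ι → Fin d → M) (ι → Fin d → M) where
  init := indep fun r => Λ.init (midIdent r) (midDeg ι r) x₀
  out s i k := Λ.msg (s (Sum.inl k))
    ((midPort ι (Sum.inl k : Mid d L)).symm (Sum.inr ⟨(i, k), rfl⟩) : Fin _)
  step s m := indep fun r => Λ.step (s r) (midDeg ι r) (midIncoming Λ s m r)

theorem irrevocable_middle (x₀ : X) (r : Mid d L) :
    (middle ι d L Λ x₀).Irrevocable fun s => Λ.out (s r) :=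
  fun _ _ y hy _ hs' => Λ.out_step _ _ _ y hy _ (mem_support_of_mem_support_indep hs' r)

end Middle

section Join

variable {ι : Type} {d : ℕ} (N : ι → Rooted d) (L : ℕ)

/-- The vertices of the joined network. -/
abbrev JoinVertex : Type := Mid d L ⊕ Σ i, (N i).Other

/-- The edges at a vertex of the joined network. -/
def JoinNb : JoinVertex N L → Type
  | Sum.inl r => MidNb ι r
  | Sum.inr v => (N v.1).net.G.neighborSet v.2

/-- The other ends of the edges of the joined network. -/
def joinDir : ∀ w, JoinNb N L w → JoinVertex N L
  | Sum.inl _ =>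
    Sum.elim (fun r' => Sum.inl r'.1) fun p => Sum.inr ⟨p.1.1, (N p.1.1).neighbor p.1.2⟩
  | Sum.inr v => (N v.1).dir (fun v' => Sum.inr ⟨v.1, v'⟩) (fun k => Sum.inl (Sum.inl k)) v.2

section JoinDir

variable {N L} {i : ι} {v : (N i).Other} {u : (N i).net.G.neighborSet v}

theorem joinDir_inr_of_eq (h : (u : Fin (N i).net.n) = (N i).root) :
    joinDir N L (Sum.inr ⟨i, v⟩) u = Sum.inl (Sum.inl ((N i).portTo ((N i).adj_root h))) :=
  dif_pos h

theorem joinDir_inr_of_ne (h : (u : Fin (N i).net.n) ≠ (N i).root) :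
    joinDir N L (Sum.inr ⟨i, v⟩) u = Sum.inr ⟨i, ⟨u, h⟩⟩ :=
  dif_neg h

theorem joinDir_neighbor_root (k : Fin d) :
    joinDir N L (Sum.inr ⟨i, (N i).neighbor k⟩) ⟨(N i).root, (N i).adj_neighbor k⟩ =
      Sum.inl (Sum.inl k) := by
  rw [joinDir_inr_of_eq rfl, Rooted.portTo_neighbor]

theorem joinDir_portTo (h : (N i).net.G.Adj v (N i).root) :
    joinDir N L (Sum.inl (Sum.inl ((N i).portTo h)))
      (Sum.inr ⟨(i, (N i).portTo h), rfl⟩) = Sum.inr ⟨i, v⟩ := by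
  simp only [joinDir, Sum.elim_inr, Rooted.neighbor_portTo]

end JoinDir

theorem joinDir_injective : ∀ w, Function.Injective (joinDir N L w)
  | Sum.inl r => by
    rintro (⟨r', _⟩ | ⟨⟨i, k⟩, _⟩) (⟨r'', _⟩ | ⟨⟨j, l⟩, _⟩) h <;>
      simp only [joinDir, Sum.elim_inl, Sum.elim_inr, Sum.inl.injEq, Sum.inr.injEq, reduceCtorEq,
        Sigma.mk.injEq] at h
    · subst h
      rfl
    · obtain ⟨rfl, h⟩ := h
      obtain rfl := (N i).neighbor_injective (eq_of_heq h)
      rfl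
  | Sum.inr v => (N v.1).dir_injective (W := JoinVertex N L) (f := fun v' => Sum.inr ⟨v.1, v'⟩)
      (Sum.inr_injective.comp sigma_mk_injective) (fun _ _ => Sum.inr_ne_inl) v.2

theorem joinDir_ne : ∀ w k, joinDir N L w k ≠ w
  | Sum.inl _, Sum.inl r', h => r'.2 (Sum.inl_injective h)
  | Sum.inl _, Sum.inr _, h => Sum.inr_ne_inl h
  | Sum.inr ⟨i, v⟩, u, h => by
    by_cases hroot : (u.1 : Fin (N i).net.n) = (N i).root
    · exact Sum.inl_ne_inr ((joinDir_inr_of_eq hroot).symm.trans h)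
    · have hv := sigma_mk_injective <| Sum.inr_injective <|
        (joinDir_inr_of_ne hroot).symm.trans h
      exact (u.2 : (N i).net.G.Adj _ _).ne' (congrArg Subtype.val hv)

theorem joinDir_symm : ∀ w k, ∃ k', joinDir N L (joinDir N L w k) k' = w
  | Sum.inl r, Sum.inl r' => ⟨Sum.inl ⟨r, r'.2.symm⟩, rfl⟩
  | Sum.inl _, Sum.inr ⟨⟨_, k⟩, rfl⟩ => ⟨_, joinDir_neighbor_root k⟩
  | Sum.inr ⟨i, v⟩, u => by
    by_cases hroot : (u.1 : Fin (N i).net.n) = (N i).root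
    · rw [joinDir_inr_of_eq hroot]
      exact ⟨_, joinDir_portTo _⟩
    · rw [joinDir_inr_of_ne hroot]
      exact ⟨⟨v, SimpleGraph.Adj.symm u.2⟩, joinDir_inr_of_ne v.2⟩

/-- The joined network: the distinguished agents are removed, and the places behind their ports
are taken by vertices of a complete graph. -/
def join [Finite ι] : LocalGraph (JoinVertex N L) where
  Nb := JoinNb N L
  dir := joinDir N L
  dir_injective := joinDir_injective N L
  dir_ne := joinDir_ne N L
  dir_symm := joinDir_symm N L
  deg
    | Sum.inl r => midDeg ι r
    | Sum.inr v => (N v.1).net.deg v.2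
  port
    | Sum.inl r => midPort ι r
    | Sum.inr v => (N v.1).net.port v.2

/-- The identifiers of the joined network. -/
def joinIdent : JoinVertex N L → ℕ
  | Sum.inl r => midIdent r
  | Sum.inr v => (N v.1).net.ident v.2

variable {N} in
theorem joinIdent_injective [Encodable ι]
    (h : ∀ i (v : (N i).Other), ((N i).net.ident v).unpair.1 = Encodable.encode i + 1) :
    Function.Injective (joinIdent N L) := by
  have hmid (r : Mid d L) : (midIdent r).unpair.1 = 0 := by rw [midIdent, Nat.unpair_pair]
  rintro (r | ⟨i, v⟩) (r' | ⟨j, v'⟩) heq <;>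
    have hfst := congrArg (fun m => m.unpair.1) heq <;>
    simp only [joinIdent, hmid, h, Nat.add_right_cancel_iff] at heq hfst
  · have hr := (Nat.pair_eq_pair.1 heq).2
    rw [finSumFinEquiv.injective (Fin.ext hr)]
  · omega
  · omega
  · obtain rfl := Encodable.encode_injective hfst
    rw [Subtype.ext ((N i).net.ident_injective heq)]

variable {N L} in
/-- The inputs of the joined network. -/
def joinInput {X : Type} (x₀ : X) (x : ∀ i, (N i).Other → X) : JoinVertex N L → X :=
  Sum.elim (fun _ => x₀) fun v => x v.1 v.2

variable {N L} in
/-- The configurations of the separate parts of the joined network. -/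
def joinSplit {Z : Type} (c : JoinVertex N L → Z) : (∀ i, (N i).Other → Z) × (Mid d L → Z) :=
  (fun i v => c (Sum.inr ⟨i, v⟩), fun r => c (Sum.inl r))

theorem indep_map_joinSplit [Fintype ι] {Z : Type} (P : JoinVertex N L → PMF Z) :
    (indep P).map joinSplit =
      pmfProd (indep fun i => indep fun v => P (Sum.inr ⟨i, v⟩))
        (indep fun r => P (Sum.inl r)) := by
  rw [← PMF.map_id (indep fun r => P (Sum.inl r)), ← indep_map_curry fun v => P (Sum.inr v),
    ← pmfProd_map, ← pmfProd_map_swap, ← indep_map_sumArrow, PMF.map_comp, PMF.map_comp]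
  rfl

section Incoming

variable [Finite ι] {X M Y : Type} (Λ : Strategy X M Y) (c : JoinVertex N L → Λ.State)

theorem join_incoming_inr (x₀ : X) (i : ι) (v : (N i).Other) :
    (join N L).incoming Λ c (Sum.inr ⟨i, v⟩) =
      (N i).incoming (fun _ => Λ) (fun v => c (Sum.inr ⟨i, v⟩))
        ((middle ι d L Λ x₀).out (fun r => c (Sum.inl r)) i) v := by
  funext k
  change Fin ((N i).net.deg v) at k
  unfold Rooted.incoming
  split_ifs with hroot
  · exact (join N L).incoming_eq Λ c (w := Sum.inr ⟨i, v⟩) (k := k)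
      (joinDir_inr_of_eq hroot) (joinDir_portTo ((N i).adj_root hroot))
  · exact (join N L).incoming_eq Λ c (w := Sum.inr ⟨i, v⟩) (k := k)
      (w' := Sum.inr ⟨i, ⟨(N i).net.port v k, hroot⟩⟩)
      (k' := ⟨v, SimpleGraph.Adj.symm ((N i).net.port v k).2⟩)
      (joinDir_inr_of_ne hroot) (joinDir_inr_of_ne (N := N) (i := i) (u := ⟨v, _⟩) v.2)

theorem join_incoming_inl (x : ∀ i, (N i).Other → X) (r : Mid d L) :
    (join N L).incoming Λ c (Sum.inl r) =
      midIncoming Λ (fun r => c (Sum.inl r)) (fun i => ((N i).others (fun _ => Λ) (x i)).out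
        fun v => c (Sum.inr ⟨i, v⟩)) r := by
  funext k
  change Fin (midDeg ι r) at k
  unfold midIncoming
  rcases hk : midPort ι r k with r' | ⟨⟨i, l⟩, rfl⟩
  · exact (join N L).incoming_eq Λ c (w := Sum.inl r) (w' := Sum.inl r')
      (k' := Sum.inl ⟨r, r'.2.symm⟩)
      (congrArg (joinDir N L (Sum.inl r)) hk) rfl
  · exact (join N L).incoming_eq Λ c (w := Sum.inl (Sum.inl l))
      (w' := Sum.inr ⟨i, (N i).neighbor l⟩) (congrArg (joinDir N L (Sum.inl _)) hk)
      (joinDir_neighbor_root l)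

end Incoming

theorem vertexLaw_join [Fintype ι] {X M Y : Type} (Λ : Strategy X M Y) (x₀ : X)
    (x : ∀ i, (N i).Other → X) (t : ℕ) :
    ((join N L).vertexLaw Λ (joinIdent N L) (joinInput x₀ x) t).map joinSplit =
      Party.law (Party.pi fun i => (N i).others (fun _ => Λ) (x i)) (middle ι d L Λ x₀) t := by
  rw [LocalGraph.vertexLaw, chain_map (κ' := Party.round _ _) (fun c => ?_), indep_map_joinSplit]
  · rfl
  · rw [indep_map_joinSplit]
    simp only [join_incoming_inr N L Λ c x₀, join_incoming_inl N L Λ c x]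
    rfl

end Join

/-! ### The joined network is 2-connected -/

theorem TwoConnected.induce_connected {n : ℕ} {G : SimpleGraph (Fin n)} (h : TwoConnected G)
    {t : Set (Fin n)} (ht : tᶜ.Subsingleton) : (G.induce t).Connected := by
  rcases ht.eq_empty_or_singleton with ht | ⟨v, ht⟩
  · obtain rfl := Set.compl_empty_iff.1 ht
    exact (SimpleGraph.induceUnivIso G).connected_iff.2 h.2.1
  · obtain rfl := compl_eq_comm.1 ht
    exact h.2.2 v

theorem TwoConnected.exists_ne_ne {n : ℕ} {G : SimpleGraph (Fin n)} (h : TwoConnected G)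
    (a b : Fin n) : ∃ c, c ≠ a ∧ c ≠ b := by
  have hcard : ({a, b} : Finset (Fin n)).card < (Finset.univ : Finset (Fin n)).card := by
    rw [Finset.card_univ, Fintype.card_fin]
    exact Finset.card_le_two.trans_lt h.1
  obtain ⟨c, -, hc⟩ := Finset.exists_mem_notMem_of_card_lt_card hcard
  simp only [Finset.mem_insert, Finset.mem_singleton, not_or] at hc
  exact ⟨c, hc⟩

theorem exists_adj_reachable_induce_diff {V : Type*} {G : SimpleGraph V} {t : Set V} {v r : t}
    (h : (G.induce t).Reachable v r) (hne : (v : V) ≠ r) :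
    ∃ u : ↑(t \ {r.1}), G.Adj u r ∧ (G.induce (t \ {r.1})).Reachable ⟨v, v.2, hne⟩ u := by
  obtain ⟨p⟩ := h
  induction p with
  | nil => exact (hne rfl).elim
  | @cons v w r hadj p ih =>
    by_cases hw : (w : V) = r
    · obtain rfl := Subtype.ext hw
      exact ⟨⟨v, v.2, hne⟩, hadj, .refl _⟩
    · obtain ⟨u, hur, hu⟩ := ih hw
      have hvw : (G.induce (t \ {r.1})).Adj ⟨v, v.2, hne⟩ ⟨w, w.2, hw⟩ := hadj
      exact ⟨u, hur, hvw.reachable.trans hu⟩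

namespace Rooted

variable {d : ℕ} (N : Rooted d)

theorem exists_neighbor_reachable {t : Set (Fin N.net.n)} (ht : (N.net.G.induce t).Connected)
    (hroot : N.root ∈ t) (v : N.Other) (hv : v.1 ∈ t) :
    ∃ k, ∃ hk : (N.neighbor k).1 ∈ t, (N.net.G.induce (t \ {N.root})).Reachable
      ⟨v, hv, v.2⟩ ⟨N.neighbor k, hk, (N.neighbor k).2⟩ := by
  obtain ⟨⟨u, hu⟩, hadj, hvu⟩ :=
    exists_adj_reachable_induce_diff (ht.preconnected ⟨v, hv⟩ ⟨N.root, hroot⟩) v.2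
  have hk : N.neighbor (N.portTo (v := ⟨u, hu.2⟩) hadj) = ⟨u, hu.2⟩ := N.neighbor_portTo hadj
  refine ⟨N.portTo (v := ⟨u, hu.2⟩) hadj, ?_, ?_⟩
  · simpa only [hk] using hu.1
  · simpa only [hk] using hvu

theorem nontrivial_ports (hN : TwoConnected N.net.G) : Nontrivial (Fin d) := by
  obtain ⟨v, hv, -⟩ := hN.exists_ne_ne N.root N.root
  obtain ⟨k, -, -⟩ := N.exists_neighbor_reachable
    (hN.induce_connected (t := Set.univ) (by simp)) (Set.mem_univ _) ⟨v, hv⟩ (Set.mem_univ _)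
  obtain ⟨w, hw, hwk⟩ := hN.exists_ne_ne N.root (N.neighbor k)
  obtain ⟨l, hl, -⟩ := N.exists_neighbor_reachable (t := {(N.neighbor k).1}ᶜ)
    (hN.induce_connected (by simp)) (N.neighbor k).2.symm ⟨w, hw⟩ hwk
  exact ⟨l, k, fun h => hl (by rw [h]; rfl)⟩

end Rooted

section Join

variable {ι : Type} {d L : ℕ} {N : ι → Rooted d} {s : Set (JoinVertex N L)}

/-- The places of a network that are the distinguished one or whose vertex of the joined network
lies in `s`. -/
def visible (s : Set (JoinVertex N L)) (i : ι) : Set (Fin (N i).net.n) :=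
  {v | ∀ h : v ≠ (N i).root, Sum.inr ⟨i, ⟨v, h⟩⟩ ∈ s}

theorem root_mem_visible (s : Set (JoinVertex N L)) (i : ι) : (N i).root ∈ visible s i :=
  fun h => (h rfl).elim

theorem compl_visible_subsingleton (hs : sᶜ.Subsingleton) (i : ι) :
    (visible s i)ᶜ.Subsingleton := by
  intro v hv w hw
  simp only [visible, Set.mem_compl_iff, Set.mem_ofPred_eq, not_forall] at hv hw
  obtain ⟨hv, hvs⟩ := hv
  obtain ⟨hw, hws⟩ := hw
  simpa using hs hvs hws

theorem card_joinVertex [Fintype ι] :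
    Fintype.card (JoinVertex N L) = d + L + ∑ i, ((N i).net.n - 1) := by
  simp [JoinVertex, Mid, Rooted.Other, Fintype.card_subtype_compl]

/-- If a port vertex is missing, then nothing else is, and the network stays connected without
its distinguished agent. -/
theorem exists_neighbor_reachable_of_subsingleton {i : ι} (hN : TwoConnected (N i).net.G)
    (hs : sᶜ.Subsingleton) (v : ↑(visible s i \ {(N i).root})) :
    ∃ k, Sum.inl (Sum.inl k) ∈ s ∧ ∃ hk : ((N i).neighbor k).1 ∈ visible s i,
      ((N i).net.G.induce (visible s i \ {(N i).root})).Reachable v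
        ⟨(N i).neighbor k, hk, ((N i).neighbor k).2⟩ := by
  by_cases hall : ∀ k, Sum.inl (Sum.inl k) ∈ s
  · obtain ⟨k, hk, hreach⟩ := (N i).exists_neighbor_reachable
      (hN.induce_connected (compl_visible_subsingleton hs i)) (root_mem_visible s i)
      ⟨v, v.2.2⟩ v.2.1
    exact ⟨k, hall k, hk, hreach⟩
  · push Not at hall
    obtain ⟨k₀, hk₀⟩ := hall
    have hmem : ∀ w, w ≠ Sum.inl (Sum.inl k₀) → w ∈ s := fun w hw =>
      not_not.1 fun h => hw (hs h hk₀)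
    have huniv : visible s i \ {(N i).root} = {(N i).root}ᶜ :=
      Set.ext fun _ => and_iff_right fun _ => hmem _ Sum.inr_ne_inl
    have := (N i).nontrivial_ports hN
    obtain ⟨k, hk⟩ := exists_ne k₀
    have hconn : ((N i).net.G.induce (visible s i \ {(N i).root})).Connected :=
      huniv ▸ hN.2.2 _
    exact ⟨k, hmem _ fun h => hk (Sum.inl_injective (Sum.inl_injective h)),
      fun _ => hmem _ Sum.inr_ne_inl, hconn.preconnected _ _⟩

variable [Finite ι]

theorem join_adj_inr {i : ι} {v w : (N i).Other} (h : (N i).net.G.Adj v w) :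
    (join N L).graph.Adj (Sum.inr ⟨i, v⟩) (Sum.inr ⟨i, w⟩) :=
  ⟨⟨w, h⟩, joinDir_inr_of_ne (N := N) (v := v) w.2⟩

/-- The network without its distinguished agent, inside the joined network. -/
def visibleHom (s : Set (JoinVertex N L)) (i : ι) :
    (N i).net.G.induce (visible s i \ {(N i).root}) →g (join N L).graph.induce s where
  toFun v := ⟨Sum.inr ⟨i, ⟨v, v.2.2⟩⟩, v.2.1 v.2.2⟩
  map_rel' {v w} h := join_adj_inr (N := N) (i := i) (v := ⟨v, v.2.2⟩) (w := ⟨w, w.2.2⟩) h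

theorem exists_port_reachable {i : ι} (hN : TwoConnected (N i).net.G) (hs : sᶜ.Subsingleton)
    (v : (N i).Other) (hv : Sum.inr ⟨i, v⟩ ∈ s) :
    ∃ k, ∃ hk : Sum.inl (Sum.inl k) ∈ s,
      ((join N L).graph.induce s).Reachable ⟨Sum.inr ⟨i, v⟩, hv⟩ ⟨Sum.inl (Sum.inl k), hk⟩ := by
  obtain ⟨k, hks, hk, hreach⟩ :=
    exists_neighbor_reachable_of_subsingleton hN hs ⟨v, fun _ => hv, v.2⟩
  have hadj : ((join N L).graph.induce s).Adj
      ⟨Sum.inr ⟨i, (N i).neighbor k⟩, hk ((N i).neighbor k).2⟩ ⟨Sum.inl (Sum.inl k), hks⟩ :=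
    ⟨⟨(N i).root, (N i).adj_neighbor k⟩, joinDir_neighbor_root (N := N) k⟩
  have hmap : ((join N L).graph.induce s).Reachable ⟨Sum.inr ⟨i, v⟩, hv⟩
      ⟨Sum.inr ⟨i, (N i).neighbor k⟩, hk ((N i).neighbor k).2⟩ := hreach.map (visibleHom s i)
  exact ⟨k, hks, hmap.trans hadj.reachable⟩

theorem join_induce_connected [Nonempty ι] (hN : ∀ i, TwoConnected (N i).net.G)
    (hs : sᶜ.Subsingleton) : ((join N L).graph.induce s).Connected := by
  obtain ⟨k, l, hkl⟩ := (N (Classical.arbitrary ι)).nontrivial_ports (hN _)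
  obtain ⟨r₀, hr₀⟩ : ∃ r, Sum.inl r ∈ s := by
    by_contra! hnot
    exact hkl (Sum.inl_injective (Sum.inl_injective (hs (hnot (Sum.inl k)) (hnot (Sum.inl l)))))
  have hmid (r : Mid d L) (hr : Sum.inl r ∈ s) :
      ((join N L).graph.induce s).Reachable ⟨Sum.inl r, hr⟩ ⟨Sum.inl r₀, hr₀⟩ := by
    rcases eq_or_ne r₀ r with rfl | h
    · exact .refl _
    · exact SimpleGraph.Adj.reachable ⟨Sum.inl ⟨r₀, h⟩, rfl⟩
  rw [SimpleGraph.connected_iff_exists_forall_reachable]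
  refine ⟨⟨Sum.inl r₀, hr₀⟩, ?_⟩
  rintro ⟨r | ⟨i, v⟩, hw⟩
  · exact (hmid r hw).symm
  · obtain ⟨k, hk, hreach⟩ := exists_port_reachable (hN i) hs v hw
    exact (hreach.trans (hmid _ hk)).symm

end Join

/-! ### Honest executions -/

section Honest

section Uniform

variable {α X Y : Type} [Fintype Y]

theorem prob_uniformOfFintype [Fintype α] [Nonempty α] (E : α → Prop) :
    prob (PMF.uniformOfFintype α) E = Nat.card {a // E a} / Fintype.card α := by
  classical
  rw [← toOuterMeasure_eq_prob, PMF.toOuterMeasure_uniformOfFintype_apply, Nat.card_eq_fintype_card]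
  rfl

theorem sum_prob_eq (μ : PMF α) (f : α → Y) : ∑ y, prob μ (fun a => f a = y) = 1 := by
  classical
  calc ∑ y, prob μ (fun a => f a = y)
      = expect μ fun a => ∑ y, iverson (f a = y) := by
        simp only [prob, expect, Finset.mul_sum]
        exact (Summable.tsum_finsetSum fun _ _ => ENNReal.summable).symm
    _ = 1 := by simp [iverson, expect_const]

theorem prob_uniformOfFintype_eq_inv_card [Fintype α] [Nonempty α] {f : α → Y}
    (hf : ∀ y y', Nat.card {a // f a = y} = Nat.card {a // f a = y'}) (y : Y) :
    prob (PMF.uniformOfFintype α) (fun a => f a = y) = (Fintype.card Y : ℝ≥0∞)⁻¹ := by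
  refine ENNReal.eq_inv_of_mul_eq_one_left ?_
  rw [← sum_prob_eq (PMF.uniformOfFintype α) f, mul_comm, ← nsmul_eq_mul, ← Finset.card_univ,
    ← Finset.sum_const]
  exact Finset.sum_congr rfl fun y' _ => by
    rw [prob_uniformOfFintype, prob_uniformOfFintype, hf y y']

theorem FullKnowledge.prob_eq_inv_card [Fintype X] [Nonempty X] {q : ∀ m : ℕ, (Fin m → X) → Y}
    (hq : FullKnowledge q) [Fintype α] [DecidableEq α] {m : ℕ} {g : (α → X) → Fin m → X} {v : α}
    {j : Fin m} (hg : ∀ x z, g (Function.update x v z) = Function.update (g x) j z) (y : Y) :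
    prob (PMF.uniformOfFintype (α → X)) (fun x => q m (g x) = y) = (Fintype.card Y : ℝ≥0∞)⁻¹ := by
  have hcoord (x : α → X) : prob (PMF.uniformOfFintype X)
      (fun z => q m (g (Function.update x v z)) = y) = (Fintype.card Y : ℝ≥0∞)⁻¹ := by
    simp only [hg]
    exact prob_uniformOfFintype_eq_inv_card (fun y y' => hq m j (g x) y y') y
  unfold prob at hcoord ⊢
  rw [uniformOfFintype_pi_eq_indep, expect_indep_update _ v]
  simp only [hcoord, expect_const]

end Uniform

variable {X M Y : Type} {Λ : Strategy X M Y}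

theorem persistent_outputs (N : Network) (p : Y) :
    Persistent (fun c => indep fun v => Λ.step (c v) (N.deg v) (received N c v))
      fun c : Config N fun _ => Λ => ∀ v, outputs N c v = some p := by
  intro c hc c' hc' v
  rw [outputs, Option.join_eq_some_iff]
  exact Λ.out_step _ _ _ _ (Option.join_eq_some_iff.1 (hc v)) _
    (mem_support_of_mem_support_indep hc' v)

variable {q : ∀ m : ℕ, (Fin m → X) → Y} {σ : PMF ℕ}

theorem SolvesKnowledgeSharing.iSup_prob_outputs_eq (hΛ : SolvesKnowledgeSharing q σ Λ)
    {N : Network} (hN : TwoConnected N.G) (hσ : N.n ∈ σ.support) (x : Fin N.n → X) :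
    ⨆ t, prob (configLaw N (fun _ => Λ) x t) (fun c =>
      ∀ v, outputs N c v = some (q N.n x)) = 1 := by
  simpa only [toOuterMeasure_eq_prob] using hΛ N hN hσ x

theorem SolvesKnowledgeSharing.runUtility_eq_iverson (hΛ : SolvesKnowledgeSharing q σ Λ)
    {N : Network} (hN : TwoConnected N.G) (hσ : N.n ∈ σ.support) (a : Fin N.n) (p : Y)
    (x : Fin N.n → X) : runUtility N (fun _ => Λ) a p x = iverson (q N.n x = p) := by
  have hcorrect := hΛ.iSup_prob_outputs_eq hN hσ x
  have hprob : runUtility N (fun _ => Λ) a p x =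
      ⨆ t, prob (configLaw N (fun _ => Λ) x t) fun c => ∀ v, outputs N c v = some p := by
    simp only [runUtility, utility_eq_iverson, prob, expect]
  rw [hprob]
  by_cases hp : q N.n x = p
  · rw [iverson_true hp, ← hcorrect, hp]
  · have hmono (y : Y) : Monotone fun t =>
        prob (configLaw N (fun _ => Λ) x t) fun c => ∀ v, outputs N c v = some y := by
      simp only [configLaw_eq_chain]
      exact (persistent_outputs N y).prob_chain_mono _
    rw [iverson_false hp, ← nonpos_iff_eq_zero]
    refine (iSup_prob_le_iSup_prob (E' := fun _ => False) (hmono _) (hmono p) hcorrect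
      fun t c _ hq hcp => hp (Option.some_injective _ ((hq a).symm.trans (hcp a)))).trans ?_
    simp [prob, iverson, expect_const]

variable [Fintype X] [Nonempty X] [Fintype Y]

theorem SolvesKnowledgeSharing.networkUtility_honest (hΛ : SolvesKnowledgeSharing q σ Λ)
    (hq : FullKnowledge q) {N : PointedNetwork} (hN : TwoConnected N.1.G) (hσ : N.1.n ∈ σ.support)
    (p : Y) (i : X) : networkUtility Λ Λ p i N = (Fintype.card Y : ℝ≥0∞)⁻¹ := by
  obtain ⟨v, hv, -⟩ := hN.exists_ne_ne N.2 N.2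
  rw [← hq.prob_eq_inv_card (g := fun x => Function.update x N.2 i)
    (fun x z => Function.update_comm hv z i x) p]
  simp only [networkUtility, Function.update_eq_self, hΛ.runUtility_eq_iverson hN hσ]
  rfl

end Honest

/-! ### Deviations -/

section Deviations

variable {X M Y : Type}

theorem Rooted.consensusProb_eq_of_hom {d : ℕ} {Z : Type} (N : Rooted d)
    (prof : N.Other → Strategy X M Y) {S : Strategy X M Y} {P : Party Z (Fin d → M) (Fin d → M)}
    {i : X} (f : Hom P (S.toParty (N.net.ident N.root) d i)) (x : N.Other → X) (p : Y) :
    N.consensusProb prof S x i p = ⨆ t, prob (law (N.others prof x) P t) fun g =>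
      (∀ v, (prof v).out (g.1 v) = some (some p)) ∧ S.out (f.map g.2) = some (some p) := by
  refine iSup_congr fun t => ?_
  rw [← law_map (Hom.id _) f, prob_map]
  rfl

section Deviation

variable {d : ℕ} {Z : Type} (Λ : Strategy X M Y) (P : Party Z (Fin d → M) (Fin d → M))
  (o : Z → Option (Option Y)) (ho : P.Irrevocable o) (m₀ : M)

/-- The strategy that behaves as the party `P`, with outputs `o`, if the degree is `d`, and as `Λ`
otherwise. The message `m₀` only fills the ports that do not exist. -/
def deviation : Strategy X M Y where
  State := Λ.State ⊕ Z
  init ident deg x :=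
    if deg = d then P.init.map .inr else (Λ.init ident deg x).map .inl
  msg s k := match s with
    | .inl s => Λ.msg s k
    | .inr z => if h : k < d then P.out z ⟨k, h⟩ else m₀
  step s deg r := match s with
    | .inl s => (Λ.step s deg r).map .inl
    | .inr z => if h : deg = d then (P.step z fun k => r (Fin.cast h.symm k)).map .inr
      else PMF.pure (.inr z)
  out := Sum.elim Λ.out o
  out_step := by
    rintro (s | z) deg r y hy s' hs'
    · obtain ⟨s', hstep, rfl⟩ := (PMF.mem_support_map_iff _ _ _).1 hs'
      exact Λ.out_step s deg r y hy s' hstep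
    · simp only at hs'
      by_cases h : deg = d
      · rw [dif_pos h] at hs'
        obtain ⟨z', hstep, rfl⟩ := (PMF.mem_support_map_iff _ _ _).1 hs'
        exact ho z _ _ hy z' hstep
      · rw [dif_neg h, PMF.mem_support_pure_iff] at hs'
        rwa [hs']

/-- At degree `d` the deviation is `P`. -/
def deviationHom (ident : ℕ) (x : X) : Hom P ((deviation Λ P o ho m₀).toParty ident d x) where
  map := .inr
  init := by simp [Strategy.toParty, deviation]
  out z := by funext k; simp [Strategy.toParty, deviation]
  step z m := by simp [Strategy.toParty, deviation]

/-- At any other degree the deviation is `Λ`. -/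
def honestHom {d' : ℕ} (h : d' ≠ d) (ident : ℕ) (x : X) :
    Hom (Λ.toParty ident d' x) ((deviation Λ P o ho m₀).toParty ident d' x) where
  map := .inl
  init := by simp [Strategy.toParty, deviation, h]
  out _ := rfl
  step _ _ := rfl

variable [Fintype X] [Nonempty X]

theorem networkUtility_deviation (N : Rooted d) (p : Y) (i : X) :
    networkUtility Λ (deviation Λ P o ho m₀) p i ⟨N.net, N.root⟩ =
      expect (PMF.uniformOfFintype (N.Other → X)) fun x =>
        ⨆ t, prob (law (N.others (fun _ => Λ) x) P t) fun g =>
          (∀ v, Λ.out (g.1 v) = some (some p)) ∧ o g.2 = some (some p) := by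
  rw [N.networkUtility_eq]
  exact congrArg _ <| funext fun x =>
    N.consensusProb_eq_of_hom _ (deviationHom Λ P o ho m₀ _ i) x p

theorem networkUtility_deviation_of_deg_ne {N : PointedNetwork} (h : N.1.deg N.2 ≠ d) (p : Y)
    (i : X) : networkUtility Λ (deviation Λ P o ho m₀) p i N = networkUtility Λ Λ p i N := by
  let R : Rooted (N.1.deg N.2) := ⟨N.1, N.2, rfl⟩
  refine (R.networkUtility_eq Λ _ p i).trans (Eq.trans ?_ (R.networkUtility_eq Λ Λ p i).symm)
  exact congrArg _ <| funext fun x => R.consensusProb_eq_of_hom _ (honestHom Λ P o ho m₀ h _ i) x p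

end Deviation

theorem Strategy.nonempty_message (S : Strategy X M Y) (x : X) : Nonempty M := by
  obtain ⟨s, -⟩ := (S.init 0 0 x).support_nonempty
  exact ⟨S.msg s 0⟩

end Deviations

/-! ### The joined network decides the value -/

section JoinValue

variable {ι X M Y : Type} {d L : ℕ} {N : ι → Rooted d}

/-- All agents around the middle part and all agents in it have output `y`. -/
def AllOutput (Λ : Strategy X M Y) (y : Y)
    (g : (∀ i, (N i).Other → Λ.State) × (Mid d L → Λ.State)) : Prop :=
  (∀ i v, Λ.out (g.1 i v) = some (some y)) ∧ ∀ r, Λ.out (g.2 r) = some (some y)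

theorem allOutput_joinSplit {Λ : Strategy X M Y} {y : Y} {c : JoinVertex N L → Λ.State} :
    AllOutput Λ y (joinSplit c) ↔ ∀ w, Λ.out (c w) = some (some y) := by
  rw [Sum.forall, Sigma.forall, and_comm]
  rfl

variable [Fintype ι]

/-- The value of `q` at the inputs of the joined network. -/
def joinValue (q : ∀ m : ℕ, (Fin m → X) → Y) (L : ℕ) (x₀ : X) (x : ∀ i, (N i).Other → X) : Y :=
  q (Fintype.card (JoinVertex N L)) (joinInput x₀ x ∘ (Fintype.equivFin (JoinVertex N L)).symm)

variable {Λ : Strategy X M Y} {q : ∀ m : ℕ, (Fin m → X) → Y} {x₀ : X} {x : ∀ i, (N i).Other → X}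

theorem persistent_allOutput (y : Y) :
    Persistent (round (pi fun i => (N i).others (fun _ => Λ) (x i)) (middle ι d L Λ x₀))
      (AllOutput Λ y) := by
  intro g hg g' hg'
  obtain ⟨hothers, hmid⟩ := mem_support_pmfProd.1 hg'
  exact ⟨fun i v => Λ.out_step _ _ _ _ (hg.1 i v) _ <|
    mem_support_of_mem_support_indep (mem_support_of_mem_support_indep hothers i) v,
    fun r => irrevocable_middle Λ x₀ r _ _ _ (hg.2 r) _ hmid⟩

theorem FullKnowledge.prob_joinValue [Nonempty ι] [Fintype X] [Nonempty X] [Fintype Y]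
    (hq : FullKnowledge q) (hN : ∀ i, TwoConnected (N i).net.G) (p : Y) :
    prob (indep fun i => PMF.uniformOfFintype ((N i).Other → X))
      (fun x => joinValue q L x₀ x = p) = (Fintype.card Y : ℝ≥0∞)⁻¹ := by
  classical
  obtain ⟨i⟩ := (inferInstance : Nonempty ι)
  obtain ⟨v, hv, -⟩ := (hN i).exists_ne_ne (N i).root (N i).root
  simp only [uniformOfFintype_pi_eq_indep]
  rw [← indep_map_curry fun _ => PMF.uniformOfFintype X, prob_map, ← uniformOfFintype_pi_eq_indep]
  refine hq.prob_eq_inv_card (v := ⟨i, v, hv⟩) (j := Fintype.equivFin _ (.inr ⟨i, v, hv⟩))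
    (fun x z => ?_) p
  calc joinInput x₀ (Equiv.piCurry _ (Function.update x ⟨i, v, hv⟩ z)) ∘ (Fintype.equivFin _).symm
      = Function.update (Sum.elim (fun _ => x₀) x) (.inr ⟨i, v, hv⟩) z ∘
          (Fintype.equivFin _).symm := congrArg (· ∘ _) (Sum.elim_update_right _ _ _ _)
    _ = _ := Function.update_comp_equiv _ _ _ _

variable [Encodable ι] [Nonempty ι] {n₀ : ℕ} {σ : PMF ℕ}

theorem SolvesKnowledgeSharing.iSup_prob_allOutput (hΛ : SolvesKnowledgeSharing q σ Λ)
    (hσ : ∀ m > n₀, 0 < σ m) (hL : n₀ < L) (hN : ∀ i, TwoConnected (N i).net.G)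
    (hident : ∀ i (v : (N i).Other), ((N i).net.ident v).unpair.1 = Encodable.encode i + 1) :
    ⨆ t, prob (law (pi fun i => (N i).others (fun _ => Λ) (x i)) (middle ι d L Λ x₀) t)
      (AllOutput Λ (joinValue q L x₀ x)) = 1 := by
  have hinj := joinIdent_injective L hident
  have hcard : n₀ < Fintype.card (JoinVertex N L) := by
    rw [card_joinVertex]
    omega
  have h3 : 3 ≤ Fintype.card (JoinVertex N L) := by
    obtain ⟨i⟩ := (inferInstance : Nonempty ι)
    have hsum := Finset.single_le_sum (f := fun i => (N i).net.n - 1) (fun _ _ => Nat.zero_le _)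
      (Finset.mem_univ i)
    have hi := (hN i).1
    rw [card_joinVertex]
    omega
  rw [← hΛ.iSup_prob_outputs_eq ((join N L).twoConnected_net hinj h3 fun s hs =>
    join_induce_connected hN hs) ((PMF.mem_support_iff _ _).2 (hσ _ hcard).ne')
    (joinInput x₀ x ∘ (Fintype.equivFin (JoinVertex N L)).symm)]
  refine iSup_congr fun t => ?_
  rw [← vertexLaw_join, prob_map, ← (join N L).configLaw_net Λ hinj, prob_map]
  refine prob_congr fun c _ => ?_
  rw [allOutput_joinSplit, ← (Fintype.equivFin (JoinVertex N L)).forall_congr_right]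
  simp only [outputs, Option.join_eq_some_iff]
  rfl

theorem SolvesKnowledgeSharing.decides_joinValue (hΛ : SolvesKnowledgeSharing q σ Λ)
    (hσ : ∀ m > n₀, 0 < σ m) (hL : n₀ < L) (hN : ∀ i, TwoConnected (N i).net.G)
    (hident : ∀ i (v : (N i).Other), ((N i).net.ident v).unpair.1 = Encodable.encode i + 1)
    (r : Mid d L) (p : Y) :
    Decides (fun i => (N i).others (fun _ => Λ) (x i)) (middle ι d L Λ x₀)
      (fun _ => joinValue q L x₀ x = p) (AllOutput Λ (joinValue q L x₀ x))
      fun s => Λ.out (s r) = some (some p) where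
  good_iff _ _ _ := Iff.rfl
  persistent_correct := persistent_allOutput _
  persistent_accept _ h _ hg :=
    irrevocable_middle Λ x₀ r _ _ _ h _ (mem_support_pmfProd.1 hg).2
  accept_iff g hg := by
    rw [hg.2 r, Option.some_inj, Option.some_inj]
  eventually_correct := hΛ.iSup_prob_allOutput hσ hL hN hident

end JoinValue

/-! ### Random halves -/

/-- The network with identifier zero at the distinguished agent and identifiers `Nat.pair (b + 1) v`
elsewhere, so that distinct `b` give disjoint families of identifiers of the other agents. -/
def withIdent (b : ℕ) (T : PointedTopology) : PointedNetwork :=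
  ⟨{ T.1 with
      ident v := if v = T.2 then 0 else Nat.pair (b + 1) v
      ident_injective v w h := by
        have hne : ∀ u : ℕ, Nat.pair (b + 1) u ≠ 0 := fun u hu => by
          simpa [hu] using Nat.left_le_pair (b + 1) u
        simp only at h
        split_ifs at h with hv hw hw
        · rw [hv, hw]
        · exact (hne _ h.symm).elim
        · exact (hne _ h).elim
        · exact Fin.ext (Nat.pair_eq_pair.1 h).2 }, T.2⟩

theorem map_withIdent_topology (b : ℕ) (τ : PMF PointedTopology) :
    (τ.map (withIdent b)).map PointedNetwork.topology = τ := by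
  rw [PMF.map_comp]
  exact PMF.map_id τ

theorem withIdent_ident_root (b : ℕ) (T : PointedTopology) :
    (withIdent b T).1.ident (withIdent b T).2 = 0 :=
  if_pos rfl

/-- The 2-connected topologies seen from an agent of degree `d`. -/
abbrev RootedTopology (d : ℕ) : Type :=
  {T : PointedTopology // TwoConnected T.1.G ∧ T.1.deg T.2 = d}

section Halves

variable {X M Y : Type} {d L : ℕ}

/-- `withIdent b T`, as a network seen from an agent of degree `d`. -/
def rooted (b : ℕ) (T : RootedTopology d) : Rooted d := ⟨(withIdent b T).1, T.1.2, T.2.2⟩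

theorem unpair_ident_rooted (b : ℕ) (T : RootedTopology d) (v : (rooted b T).Other) :
    ((rooted b T).net.ident v).unpair.1 = b + 1 := by
  have hv : (rooted b T).net.ident v = Nat.pair (b + 1) v.1 := if_neg v.2
  rw [hv, Nat.unpair_pair]

variable [Fintype X] [Nonempty X]

/-- A random topology and uniformly random inputs of the agents other than the distinguished one. -/
def randomHalf (X : Type) [Fintype X] [Nonempty X] (b : ℕ) (π : PMF (RootedTopology d)) :
    PMF (Σ T : RootedTopology d, (rooted b T).Other → X) :=
  pmfSigma π fun T => PMF.uniformOfFintype ((rooted b T).Other → X)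

/-- The other agents of a random topology, running `Λ` with random inputs, as one party. -/
def half (Λ : Strategy X M Y) (b : ℕ) (π : PMF (RootedTopology d)) :
    Party (Σ h : Σ T : RootedTopology d, (rooted b T).Other → X,
      (rooted b h.1).Other → Λ.State) (Fin d → M) (Fin d → M) :=
  mix (randomHalf X b π) fun h => (rooted b h.1).others (fun _ => Λ) h.2

theorem prob_law_half_le {Z : Type} (Λ : Strategy X M Y) (b : ℕ) (π : PMF (RootedTopology d))
    (P : Party Z (Fin d → M) (Fin d → M)) (o : Z → Option (Option Y))
    (ho : P.Irrevocable o) (m₀ : M) (p : Y) (i : X) (t : ℕ) :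
    prob (law (half Λ b π) P t)
        (fun g => (∀ v, Λ.out (g.1.2 v) = some (some p)) ∧ o g.2 = some (some p)) ≤
      expect π fun T => networkUtility Λ (deviation Λ P o ho m₀) p i (withIdent b T.1) := by
  rw [half, prob_law_mix, randomHalf, expect_pmfSigma]
  refine expect_mono fun T _ => ?_
  refine le_of_le_of_eq ?_ (networkUtility_deviation Λ P o ho m₀ (rooted b T) p i).symm
  exact expect_mono fun x _ => le_iSup_of_le t le_rfl

variable {ι : Type} [Fintype ι] [Nonempty ι] {q : ∀ m : ℕ, (Fin m → X) → Y}

/-- The value of `q` at the inputs of the network joined from the halves `h`. -/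
def halvesValue [Encodable ι] (q : ∀ m : ℕ, (Fin m → X) → Y) (L : ℕ) (x₀ : X)
    (h : ∀ i : ι, Σ T : RootedTopology d, (rooted (Encodable.encode i) T).Other → X) : Y :=
  joinValue (N := fun i => rooted (Encodable.encode i) (h i).1) q L x₀ fun i => (h i).2

theorem FullKnowledge.prob_halvesValue [Encodable ι] [Fintype Y] (hq : FullKnowledge q) (x₀ : X)
    (π : PMF (RootedTopology d)) (p : Y) :
    prob (indep fun i : ι => randomHalf X (Encodable.encode i) π)
      (fun h => halvesValue q L x₀ h = p) = (Fintype.card Y : ℝ≥0∞)⁻¹ := by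
  simp only [randomHalf]
  rw [indep_pmfSigma, prob_map, prob, expect_pmfSigma,
    ← expect_const (indep fun _ : ι => π) (Fintype.card Y : ℝ≥0∞)⁻¹]
  exact expect_congr fun T _ => hq.prob_joinValue (fun i => (T i).2.1) p

theorem SolvesKnowledgeSharing.decides_halvesValue [Encodable ι] {n₀ : ℕ} {σ : PMF ℕ}
    {Λ : Strategy X M Y} (hΛ : SolvesKnowledgeSharing q σ Λ) (hσ : ∀ m > n₀, 0 < σ m)
    (hL : n₀ < L) (x₀ : X) (π : PMF (RootedTopology d)) (r : Mid d L) (p : Y) :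
    Decides (fun i : ι => half Λ (Encodable.encode i) π) (middle ι d L Λ x₀)
      (fun g => halvesValue q L x₀ (fun i => (g.1 i).1) = p)
      (fun g => AllOutput Λ (halvesValue q L x₀ fun i => (g.1 i).1) (fun i => (g.1 i).2, g.2))
      fun s => Λ.out (s r) = some (some p) := by
  have hdecides (h : ∀ i : ι, Σ T : RootedTopology d, (rooted (Encodable.encode i) T).Other → X) :=
    hΛ.decides_joinValue (x := fun i => (h i).2) (x₀ := x₀) hσ hL (fun i => (h i).1.2.1)
      (fun i => unpair_ident_rooted _ (h i).1) r p
  exact decides_mix (π := fun i => randomHalf X (Encodable.encode i) π)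
    (P := fun i h => (rooted (Encodable.encode i) h.1).others (fun _ => Λ) h.2)
    (good := fun h => halvesValue q L x₀ h = p)
    (correct := fun h => AllOutput Λ (halvesValue q L x₀ h)) hdecides

theorem FullKnowledge.prob_law_halvesValue [Encodable ι] [Fintype Y] (hq : FullKnowledge q)
    (Λ : Strategy X M Y) (x₀ : X) (π : PMF (RootedTopology d)) (p : Y) :
    prob (law (pi fun i : ι => half Λ (Encodable.encode i) π) (middle ι d L Λ x₀) 0)
      (fun g => halvesValue q L x₀ (fun i => (g.1 i).1) = p) = (Fintype.card Y : ℝ≥0∞)⁻¹ :=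
  (prob_law_pi_mix_fst (π := fun i => randomHalf X (Encodable.encode i) π)
    (P := fun i h => (rooted (Encodable.encode i) h.1).others (fun _ => Λ) h.2)
    (good := fun h => halvesValue q L x₀ h = p) 0).trans (hq.prob_halvesValue x₀ π p)

end Halves

/-! ### The prior -/

section Conditional

variable {α : Type*}

theorem exists_lt_of_lt_expect {μ : PMF α} {f : α → ℝ≥0∞} {c : ℝ≥0∞} (h : c < expect μ f) :
    ∃ a ∈ μ.support, c < f a := by
  contrapose! h
  exact (expect_mono h).trans (expect_const μ c).le

theorem prob_ne_zero {μ : PMF α} {E : α → Prop} {a : α} (ha : a ∈ μ.support) (hE : E a) :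
    prob μ E ≠ 0 := fun h => ha <| by
  simpa [iverson_true hE] using ENNReal.tsum_eq_zero.1 h a

variable (τ : PMF α) (E : α → Prop)

theorem prob_eq_tsum_subtype : prob τ E = ∑' a : {a // E a}, τ a := by
  classical
  rw [← toOuterMeasure_eq_prob, PMF.toOuterMeasure_apply]
  exact (tsum_subtype {a | E a} τ).symm

variable {τ E} (h : prob τ E ≠ 0)

/-- The conditional law given the event `E`, as a law on the outcomes that satisfy `E`. -/
def conditional (h : prob τ E ≠ 0) : PMF {a // E a} :=
  PMF.normalize (fun a : {a // E a} => τ a) (by rwa [← prob_eq_tsum_subtype])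
    (by rw [← prob_eq_tsum_subtype]; exact prob_ne_top τ E)

theorem mem_support_of_mem_support_conditional {a : {a // E a}}
    (ha : a ∈ (conditional h).support) : (a : α) ∈ τ.support :=
  (PMF.mem_support_normalize_iff (f := fun a : {a // E a} => τ a) _ _ _).1 ha

theorem expect_eq_conditional_add (f : α → ℝ≥0∞) :
    expect τ f = prob τ E * expect (conditional h) (fun a => f a) +
      expect τ fun a => iverson (¬E a) * f a := by
  have hcond : prob τ E * expect (conditional h) (fun a => f a) =
      expect τ fun a => iverson (E a) * f a := by
    classical
    have hscale (a : {a // E a}) : prob τ E * (conditional h a * f a) = τ a * f a := by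
      rw [conditional, PMF.normalize_apply, ← prob_eq_tsum_subtype, mul_right_comm, mul_left_comm,
        ENNReal.mul_inv_cancel h (prob_ne_top τ E), mul_one]
    simp only [expect, ← ENNReal.tsum_mul_left, hscale]
    refine (tsum_subtype {a | E a} fun a => τ a * f a).trans (tsum_congr fun a => ?_)
    by_cases ha : E a <;> simp [iverson, ha]
  rw [hcond, ← expect_add]
  refine expect_congr fun a _ => ?_
  by_cases ha : E a <;> simp [iverson, ha]

theorem lt_expect_of_lt_expect_conditional {θ : ℝ≥0∞} {f : α → ℝ≥0∞}
    (hf : ∀ a ∈ τ.support, ¬E a → f a = θ) (hlt : θ < expect (conditional h) fun a => f a) :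
    θ < expect τ f := by
  have hoff : (expect τ fun a => iverson (¬E a) * f a) =
      expect τ fun a => iverson (¬E a) * θ := expect_congr fun a ha => by
    by_cases hE : E a
    · rw [iverson_false (not_not.2 hE), zero_mul, zero_mul]
    · rw [hf a ha hE]
  have htop : (expect τ fun a => iverson (¬E a) * θ) ≠ ∞ := by
    rw [expect_mul_const]
    exact ENNReal.mul_ne_top (prob_ne_top τ _) hlt.ne_top
  calc θ = prob τ E * θ + expect τ fun a => iverson (¬E a) * θ := by
        conv_lhs => rw [← expect_const τ θ, expect_eq_conditional_add h, expect_const]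
    _ < prob τ E * expect (conditional h) (fun a => f a) +
          expect τ fun a => iverson (¬E a) * θ :=
        ENNReal.add_lt_add_right htop (ENNReal.mul_lt_mul_right h (prob_ne_top τ E) hlt)
    _ = expect τ f := by rw [← hoff, ← expect_eq_conditional_add h]

end Conditional

section RandomInputs

variable {X M Y : Type} [Fintype X] [Nonempty X]

theorem expectedUtility_map {α : Type*} (Λ S : Strategy X M Y) (p : Y) (i : X) (τ : PMF α)
    (f : α → PointedNetwork) :
    expectedUtility Λ S p i (τ.map f) = expect τ fun a => networkUtility Λ S p i (f a) :=
  expect_map τ f _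

variable [Fintype Y] {q : ∀ m : ℕ, (Fin m → X) → Y}
  {σ : PMF ℕ} {Λ : Strategy X M Y}

theorem SolvesKnowledgeSharing.exists_profitable_party (hΛ : SolvesKnowledgeSharing q σ Λ)
    (hq : FullKnowledge q) (hσ : InfiniteSupport σ) (hk : 2 ≤ Fintype.card Y) {d : ℕ}
    (π : PMF (RootedTopology d)) (p : Y) :
    ∃ (b : ℕ) (Z : Type) (P : Party Z (Fin d → M) (Fin d → M)) (o : Z → Option (Option Y))
      (t : ℕ), P.Irrevocable o ∧ (Fintype.card Y : ℝ≥0∞)⁻¹ < prob (law (half Λ b π) P t) fun g =>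
        (∀ v, Λ.out (g.1.2 v) = some (some p)) ∧ o g.2 = some (some p) := by
  obtain ⟨n₀, hn₀⟩ := hσ
  obtain ⟨x₀⟩ := (inferInstance : Nonempty X)
  let r : Mid d (n₀ + 1) := .inr 0
  have hdecides := hΛ.decides_halvesValue (ι := Bool) hn₀ (Nat.lt_add_one n₀) x₀ π r p
  have hprob := hq.prob_law_halvesValue (ι := Bool) (L := n₀ + 1) Λ x₀ π p
  obtain ⟨i, c, z, t, hlt⟩ := hdecides.exists_profitable_switch
    (hprob.trans_ne (by simp)) (hprob.trans_lt (ENNReal.inv_lt_one.2 (by exact_mod_cast hk)))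
  refine ⟨Encodable.encode i, _, _, _, t,
    ((irrevocable_middle Λ x₀ r).rest i fun j => (half Λ (Encodable.encode j.1) π).record).switch
      (c := c) (z₀ := z), ?_⟩
  refine (hprob.symm.trans_lt hlt).trans_le (prob_mono ?_)
  rintro ⟨s, _⟩ - ⟨z', rfl, hall, hp⟩
  simp only [hp] at hall
  have hi := hall.1 i
  simp only at hi
  rw [assemble_fst_self] at hi
  exact ⟨hi, hall.2 r⟩

theorem SolvesKnowledgeSharing.exists_profitable_deviation (hΛ : SolvesKnowledgeSharing q σ Λ)
    (hq : FullKnowledge q) (hσ : InfiniteSupport σ) (hk : 2 ≤ Fintype.card Y)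
    {τ : PMF PointedTopology} (hτ : ∀ T ∈ τ.support, TwoConnected T.1.G)
    (hτσ : ∀ T ∈ τ.support, T.1.n ∈ σ.support) (p : Y) :
    ∃ (b : ℕ) (D : Strategy X M Y),
      (∀ i, (Fintype.card Y : ℝ≥0∞)⁻¹ <
        expect τ fun T => networkUtility Λ D p i (withIdent b T)) ∧
      ∃ T ∈ τ.support, ∀ i, (Fintype.card Y : ℝ≥0∞)⁻¹ < networkUtility Λ D p i (withIdent b T) := by
  obtain ⟨T₀, hT₀⟩ := τ.support_nonempty
  let d := T₀.1.deg T₀.2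
  have hd : prob τ (fun T => TwoConnected T.1.G ∧ T.1.deg T.2 = d) ≠ 0 :=
    prob_ne_zero hT₀ ⟨hτ T₀ hT₀, rfl⟩
  obtain ⟨b, Z, P, o, t, ho, hlt⟩ := hΛ.exists_profitable_party hq hσ hk (conditional hd) p
  obtain ⟨x₀⟩ := (inferInstance : Nonempty X)
  obtain ⟨m₀⟩ := Λ.nonempty_message x₀
  have hgain i := hlt.trans_le (prob_law_half_le Λ b (conditional hd) P o ho m₀ p i t)
  refine ⟨b, deviation Λ P o ho m₀, fun i => lt_expect_of_lt_expect_conditional hd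
    (fun T hT hne => ?_) (hgain i), ?_⟩
  · rw [networkUtility_deviation_of_deg_ne]
    · exact hΛ.networkUtility_honest hq (hτ T hT) (hτσ T hT) p i
    · exact fun h => hne ⟨hτ T hT, h⟩
  · obtain ⟨T, hT, hlt⟩ := exists_lt_of_lt_expect (hgain x₀)
    refine ⟨T, mem_support_of_mem_support_conditional hd hT, fun i => hlt.trans_eq ?_⟩
    exact (networkUtility_deviation Λ P o ho m₀ (rooted b T) p x₀).trans
      (networkUtility_deviation Λ P o ho m₀ (rooted b T) p i).symm

end RandomInputs

end KnowledgeSharing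

end

open KnowledgeSharing in
theorem mainTheorem1 {X M Y : Type} [Fintype X] [Nonempty X] [Fintype Y]
    (hk : 2 ≤ Fintype.card Y)
    (q : ∀ m : ℕ, (Fin m → X) → Y) (hq : FullKnowledge q)
    (σ : PMF ℕ) (hσ : InfiniteSupport σ)
    (Λ : Strategy X M Y) (hΛ : SolvesKnowledgeSharing q σ Λ)
    (τ : PMF PointedTopology) (hτ : ∀ T ∈ τ.support, TwoConnected T.1.G)
    (hτσ : τ.map (fun T => T.1.n) = σ) (p : Y) :
    ∃ (B : PMF PointedNetwork) (ident₀ : ℕ),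
      B.map PointedNetwork.topology = τ ∧
      (∀ N ∈ B.support, N.1.ident N.2 = ident₀) ∧
      ∃ D : Strategy X M Y,
        (∀ i : X, expectedUtility Λ Λ p i B < expectedUtility Λ D p i B) ∧
        ∃ N ∈ B.support, ∀ i : X, networkUtility Λ Λ p i N < networkUtility Λ D p i N := by
  have hsize : ∀ T ∈ τ.support, T.1.n ∈ σ.support := fun T hT =>
    hτσ ▸ (PMF.mem_support_map_iff _ _ _).2 ⟨T, hT, rfl⟩
  obtain ⟨b, D, hgain, T, hT, hlt⟩ := hΛ.exists_profitable_deviation hq hσ hk hτ hsize p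
  have hhonest : ∀ T ∈ τ.support, ∀ i,
      networkUtility Λ Λ p i (withIdent b T) = (Fintype.card Y : ENNReal)⁻¹ := fun T hT i =>
    hΛ.networkUtility_honest hq (N := withIdent b T) (hτ T hT) (hsize T hT) p i
  have hmap : ∀ T ∈ τ.support, withIdent b T ∈ (τ.map (withIdent b)).support := fun T hT =>
    (PMF.mem_support_map_iff _ _ _).2 ⟨T, hT, rfl⟩
  refine ⟨τ.map (withIdent b), 0, map_withIdent_topology b τ, fun N hN => ?_, D, fun i => ?_,
    withIdent b T, hmap T hT, fun i => (hhonest T hT i).trans_lt (hlt i)⟩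
  · obtain ⟨T, -, rfl⟩ := (PMF.mem_support_map_iff _ _ _).1 hN
    exact withIdent_ident_root b T
  · rw [expectedUtility_map, expectedUtility_map, expect_congr fun T hT => hhonest T hT i,
      expect_const]
    exact hgain i
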